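/- Let $0<q<1$, $\alpha>0$, let $a,x$ be real with $0<a<x$, and let $b,c,d\in\mathbb C$ satisfy $$\max\{|qxb|,\,|qxc|,\,|qxd|,\,|qxbcd|\}<1$$ (so that in particular $|qabcd|<1$). Write $(z;q)_n=\prod_{k=0}^{n-1}(1-zq^k)$, $(z;q)_\infty=\prod_{k=0}^\infty(1-zq^k)$, $(z;q)_\beta=(z;q)_\infty/(zq^\beta;q)_\infty$ for real $\beta$, and $(z_1,\dots,z_m;q)_n=\prod_{j=1}^m(z_j;q)_n$ for $n\in\{0,1,2,\dots\}\cup\{\infty\}$. Put $$h(y;p)=\prod_{k=0}^\infty\bigl(1-2pyq^k+p^2q^{2k}\bigr),\qquad h(y;p_1,\dots,p_m)=\prod_{j=1}^m h(y;p_j),$$ so that $h(i\sinh t;p)=(ipe^{t},-ipe^{-t};q)_\infty$ and $h(\cosh 2t;p)=(pe^{2t},pe^{-2t};q)_\infty$. For $t\in\mathbb R$ and $k\ge 0$ let $${}_4\phi_3\left[\begin{matrix}q^{-k},\,qab,\,qac,\,qad\\ iaqe^{t},\,-iaqe^{-t},\,qabcd\end{matrix};q,q\right]=\sum_{j=0}^{\infty}\frac{(q^{-k},qab,qac,qad;q)_j}{(q,iaqe^t,-iaqe^{-t},qabcd;q)_j}\,q^j$$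 (a terminating sum), and $$S(t)=\sum_{k=0}^\infty\frac{x^{\alpha+k}(a/x;q)_{\alpha+k}}{a^k(q;q)_{\alpha+k}}\;{}_4\phi_3\left[\begin{matrix}q^{-k},\,qab,\,qac,\,qad\\ iaqe^{t},\,-iaqe^{-t},\,qabcd\end{matrix};q,q\right].$$ Then the series $S(t)$ converges absolutely for every $t\in\mathbb R$, the integrand below is integrable over $\mathbb R$, and $$\int_{-\infty}^{\infty}\frac{h(i\sinh t;qa,qb,qc,qd)}{h(\cosh 2t;-q)}\,S(t)\,dt=\frac{(q,qab,qac,qad,qbc,qbd,qcd;q)_\infty}{(qabcd;q)_\infty}\cdot\frac{x^\alpha(a/x;q)_\alpha}{(q;q)_\alpha}\cdot\log(q^{-1}).$$ -/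

import Mathlib

/-- The finite shifted factorial `(a;q)_n = ∏_{k=0}^{n-1} (1 - a q^k)`. -/
noncomputable def qPoch (q : ℝ) (a : ℂ) (n : ℕ) : ℂ :=
  ∏ k ∈ Finset.range n, (1 - a * (q : ℂ) ^ k)

/-- The infinite shifted factorial `(a;q)_∞ = ∏_{k=0}^∞ (1 - a q^k)`. -/
noncomputable def qPochInf (q : ℝ) (a : ℂ) : ℂ :=
  ∏' k : ℕ, (1 - a * (q : ℂ) ^ k)

/-- The shifted factorial of real order `(a;q)_β = (a;q)_∞ / (a q^β;q)_∞`. -/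
noncomputable def qPochReal (q : ℝ) (a : ℂ) (β : ℝ) : ℂ :=
  qPochInf q a / qPochInf q (a * ((q ^ β : ℝ) : ℂ))

/-- The compact notation `(a₁, …, a_m;q)_n`. -/
noncomputable def qPochList (q : ℝ) (l : List ℂ) (n : ℕ) : ℂ :=
  (l.map fun a => qPoch q a n).prod

/-- The compact notation `(a₁, …, a_m;q)_∞`. -/
noncomputable def qPochInfList (q : ℝ) (l : List ℂ) : ℂ :=
  (l.map fun a => qPochInf q a).prod

/-- The basic hypergeometric series `ᵣφₛ[as; bs; q, z]`, with `r` and `s` the lengths of the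
lists `as` and `bs`. -/
noncomputable def basicHypergeometric (q : ℝ) (as bs : List ℂ) (z : ℂ) : ℂ :=
  ∑' n : ℕ, qPochList q as n / qPochList q ((q : ℂ) :: bs) n *
    ((-1 : ℂ) ^ n * (q : ℂ) ^ n.choose 2) ^ (1 + (bs.length : ℤ) - (as.length : ℤ)) * z ^ n

/-- `h(y;p) = ∏_{k=0}^∞ (1 - 2 p y q^k + p² q^{2k})`; for `y = (u + u⁻¹) / 2` this is
`(p u, p u⁻¹;q)_∞`. -/
noncomputable def askeyH (q : ℝ) (y p : ℂ) : ℂ :=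
  ∏' k : ℕ, (1 - 2 * p * y * (q : ℂ) ^ k + p ^ 2 * (q : ℂ) ^ (2 * k))

/-- `h(y;p₁, …, p_m) = h(y;p₁) ⋯ h(y;p_m)`. -/
noncomputable def askeyHList (q : ℝ) (y : ℂ) (l : List ℂ) : ℂ :=
  (l.map fun p => askeyH q y p).prod

/-- The `k`-th term
`x^{α+k} (a/x;q)_{α+k} / (a^k (q;q)_{α+k}) ·
  ₄φ₃[q^{-k}, qab, qac, qad; iaqe^t, -iaqe^{-t}, qabcd; q, q]`. -/
noncomputable def reversalTerm (q α a x : ℝ) (b c d : ℂ) (t : ℝ) (k : ℕ) : ℂ :=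
  ((x ^ (α + k) : ℝ) : ℂ) * qPochReal q ((a : ℂ) / x) (α + k) /
      ((a : ℂ) ^ k * qPochReal q q (α + k)) *
    basicHypergeometric q
      [((q : ℂ) ^ k)⁻¹, q * a * b, q * a * c, q * a * d]
      [Complex.I * a * q * Real.exp t, -Complex.I * a * q * Real.exp (-t), q * a * b * c * d]
      q

/-- The weight `h(i sinh t;qa,qb,qc,qd) / h(cosh 2t;-q)`. -/
noncomputable def reversalWeight (q a : ℝ) (b c d : ℂ) (t : ℝ) : ℂ :=
  askeyHList q (Complex.I * Real.sinh t) [q * a, q * b, q * c, q * d] /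
    askeyH q (Real.cosh (2 * t) : ℂ) (-q)

/-! The engine is Askey's integral, `integral_askeyWeight`: for |p₁p₂p₃p₄| < q³ the weight h(i sinh
t;p₁,p₂,p₃,p₄)/h(cosh 2t;-q) integrates to (q;q)_∞ log(1/q) times the six products (pᵢpⱼ/q;q)_∞,
divided by (p₁p₂p₃p₄/q³;q)_∞.

In the j-th term of the ₄φ₃ the factors (iaqe^t, -iaqe^{-t};q)_j turn h(i sinh t;qa) into h(i sinh
t;qaq^j), so weight times term is a multiple of another Askey weight. Its integral contains exactly
the reciprocal of the j-dependence of (qab,qac,qad;q)_j/(qabcd;q)_j (`interpolant_mul_integral`).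
What remains is the sum of (q^{-k};q)_j q^j/(q;q)_j over j, which vanishes unless k = 0 by the
terminating q-binomial theorem. Hence only the term k = 0 of S(t) contributes.

Exchanging sum and integral needs decay in k, since the coefficients grow like (x/a)^k. The ₄φ₃ is a
k-th q-difference, at the points q^j, of a function analytic on a disc |z| ≤ R. Such a difference
kills the Taylor monomials of degree below k, so it is O(R^{-k}) (`norm_sum_qBinomialCoeff_mul_le`).
The strict hypotheses leave room for R = y/a with y slightly above x: the series is then geometric
with ratio x/y, and the majorant is an Askey weight with first parameter qy, still integrable.

Askey's integral itself comes from the translation t ↦ t + log(1/q), under which the weight changes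
by a rational function of e^t. A telescoping function relates the integrals for p₁ and qp₁;
iteration sends the parameters to 0 one at a time. The remaining constant is found from
(q,-q,q^{3/2},-q^{3/2}), where the weight is elementary. -/

open Filter Topology MeasureTheory

/-! ### Infinite q-products: analyticity, zeros, majorants, factorization of h. -/

section qPochInf

variable {q : ℝ}

lemma summable_norm_mul_geometric (hq0 : 0 < q) (hq1 : q < 1) (a : ℂ) :
    Summable fun k : ℕ => ‖-(a * (q : ℂ) ^ k)‖ := by
  simpa [abs_of_pos hq0] using (summable_geometric_of_lt_one hq0.le hq1).mul_left ‖a‖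

lemma multipliable_qPochInf (hq0 : 0 < q) (hq1 : q < 1) (a : ℂ) :
    Multipliable fun k : ℕ => 1 - a * (q : ℂ) ^ k := by
  simpa [sub_eq_add_neg] using
    multipliable_one_add_of_summable (summable_norm_mul_geometric hq0 hq1 a)

lemma qPochInf_zero : qPochInf q 0 = 1 := by simp [qPochInf]

lemma qPochInf_eq_one_sub_mul (hq0 : 0 < q) (hq1 : q < 1) (a : ℂ) :
    qPochInf q a = (1 - a) * qPochInf q (a * q) := by
  have h := multipliable_qPochInf hq0 hq1 (a * q)
  unfold qPochInf
  rw [tprod_eq_zero_mul' (by simpa [pow_succ', mul_assoc] using h)]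
  simp [pow_succ', mul_assoc]

lemma qPochInf_eq_qPoch_mul (hq0 : 0 < q) (hq1 : q < 1) (a : ℂ) (n : ℕ) :
    qPochInf q a = qPoch q a n * qPochInf q (a * (q : ℂ) ^ n) := by
  induction n with
  | zero => simp [qPoch]
  | succ n ih =>
    rw [ih, qPochInf_eq_one_sub_mul hq0 hq1 (a * (q : ℂ) ^ n), qPoch, qPoch,
      Finset.prod_range_succ, pow_succ]
    ring_nf

lemma differentiable_qPochInf (hq0 : 0 < q) (hq1 : q < 1) : Differentiable ℂ (qPochInf q) := by
  intro z
  have hK : IsOpen (Metric.ball (0 : ℂ) (‖z‖ + 1)) := Metric.isOpen_ball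
  have hu : Summable fun k : ℕ => (‖z‖ + 1) * q ^ k :=
    (summable_geometric_of_lt_one hq0.le hq1).mul_left _
  have h := hu.hasProdLocallyUniformlyOn_nat_one_add (f := fun k (a : ℂ) => -(a * (q : ℂ) ^ k)) hK
    (.of_forall fun k x hx => by
      rw [norm_neg, norm_mul, norm_pow, Complex.norm_real, Real.norm_of_nonneg hq0.le]
      have : ‖x‖ < ‖z‖ + 1 := by simpa using hx
      gcongr) (fun k => by fun_prop)
  have hd : DifferentiableOn ℂ (fun a => ∏' k : ℕ, (1 + -(a * (q : ℂ) ^ k)))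
      (Metric.ball (0 : ℂ) (‖z‖ + 1)) :=
    h.differentiableOn (.of_forall fun _ => by
      simpa [Finset.prod_fn] using DifferentiableOn.finsetProd (fun _ _ => by fun_prop)) hK
  have := hd.differentiableAt (hK.mem_nhds (by simp : z ∈ Metric.ball (0 : ℂ) (‖z‖ + 1)))
  simpa [qPochInf, sub_eq_add_neg] using! this

lemma continuous_qPochInf (hq0 : 0 < q) (hq1 : q < 1) : Continuous (qPochInf q) :=
  (differentiable_qPochInf hq0 hq1).continuous

lemma qPochInf_ne_zero (hq0 : 0 < q) (hq1 : q < 1) {a : ℂ}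
    (ha : ∀ k : ℕ, a * (q : ℂ) ^ k ≠ 1) : qPochInf q a ≠ 0 := by
  have := tprod_one_add_ne_zero_of_summable (f := fun k : ℕ => -(a * (q : ℂ) ^ k))
    (fun k => by rw [← sub_eq_add_neg, sub_ne_zero]; exact (ha k).symm)
    (summable_norm_mul_geometric hq0 hq1 a)
  simpa [qPochInf, sub_eq_add_neg] using this

lemma mul_pow_ne_one_of_norm_lt_one (hq0 : 0 < q) (hq1 : q < 1) {a : ℂ} (ha : ‖a‖ < 1) (k : ℕ) :
    a * (q : ℂ) ^ k ≠ 1 := by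
  intro h
  have h1 : ‖a * (q : ℂ) ^ k‖ = 1 := by rw [h, norm_one]
  rw [norm_mul, norm_pow, Complex.norm_real, Real.norm_of_nonneg hq0.le] at h1
  have : q ^ k ≤ 1 := pow_le_one₀ hq0.le hq1.le
  have : 0 < q ^ k := pow_pos hq0 k
  nlinarith [norm_nonneg a]

lemma qPochInf_ne_zero_of_norm_lt_one (hq0 : 0 < q) (hq1 : q < 1) {a : ℂ} (ha : ‖a‖ < 1) :
    qPochInf q a ≠ 0 :=
  qPochInf_ne_zero hq0 hq1 (mul_pow_ne_one_of_norm_lt_one hq0 hq1 ha)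

lemma qPochInf_neg_ofReal_ne_zero (hq0 : 0 < q) (hq1 : q < 1) {r : ℝ} (hr : 0 ≤ r) :
    qPochInf q (-(r : ℂ)) ≠ 0 := by
  refine qPochInf_ne_zero hq0 hq1 fun k h => ?_
  have h' : ((-(r * q ^ k) : ℝ) : ℂ) = ((1 : ℝ) : ℂ) := by push_cast; rw [← h]; ring
  have := Complex.ofReal_injective h'
  have : 0 ≤ r * q ^ k := by positivity
  linarith

/-- The left side is purely imaginary. This is where the reality of a enters: it keeps h(i sinh
t;qa) and the denominators of the ₄φ₃ away from zero. -/
lemma mul_I_mul_pow_ne_one (r : ℝ) (k : ℕ) : Complex.I * (r : ℂ) * (q : ℂ) ^ k ≠ 1 := by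
  intro h
  have := congrArg Complex.re h
  simp [mul_assoc, ← Complex.ofReal_pow, ← Complex.ofReal_mul] at this

lemma qPochInf_I_mul_ofReal_ne_zero (hq0 : 0 < q) (hq1 : q < 1) (r : ℝ) :
    qPochInf q (Complex.I * (r : ℂ)) ≠ 0 :=
  qPochInf_ne_zero hq0 hq1 (mul_I_mul_pow_ne_one r)

/-- The maximum `(-r;q)_∞` of `‖(z;q)_∞‖` over the disc `‖z‖ ≤ r`. -/
noncomputable def qPochMajorant (q r : ℝ) : ℝ := ‖qPochInf q (-(r : ℂ))‖

/-- Factor by factor, |1 - aq^k| ≤ 1 + rq^k; the bound passes to the limit of the partial products.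
-/
lemma norm_qPochInf_le (hq0 : 0 < q) (hq1 : q < 1) {a : ℂ} {r : ℝ} (ha : ‖a‖ ≤ r) :
    ‖qPochInf q a‖ ≤ qPochMajorant q r := by
  have h1 := ((multipliable_qPochInf hq0 hq1 a).hasProd.tendsto_prod_nat).norm
  have h2 := ((multipliable_qPochInf hq0 hq1 (-(r : ℂ))).hasProd.tendsto_prod_nat).norm
  refine le_of_tendsto_of_tendsto' h1 h2 fun n => ?_
  rw [norm_prod, norm_prod]
  refine Finset.prod_le_prod (fun _ _ => norm_nonneg _) fun k _ => ?_
  have hr : 0 ≤ r := (norm_nonneg a).trans ha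
  have e : (1 - -(r : ℂ) * (q : ℂ) ^ k) = ((1 + r * q ^ k : ℝ) : ℂ) := by push_cast; ring
  rw [e, Complex.norm_real, Real.norm_of_nonneg (by positivity)]
  refine (norm_sub_le _ _).trans ?_
  rw [norm_one, norm_mul, norm_pow, Complex.norm_real, Real.norm_of_nonneg hq0.le]
  gcongr

lemma one_le_qPochMajorant (hq0 : 0 < q) (hq1 : q < 1) {r : ℝ} (hr : 0 ≤ r) :
    1 ≤ qPochMajorant q r := by
  simpa [qPochInf_zero] using norm_qPochInf_le hq0 hq1 (a := 0) (r := r) (by simpa using hr)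

lemma qPochMajorant_pos (hq0 : 0 < q) (hq1 : q < 1) {r : ℝ} (hr : 0 ≤ r) :
    0 < qPochMajorant q r :=
  one_pos.trans_le (one_le_qPochMajorant hq0 hq1 hr)

lemma qPochMajorant_mono (hq0 : 0 < q) (hq1 : q < 1) {r s : ℝ} (hr : 0 ≤ r) (hrs : r ≤ s) :
    qPochMajorant q r ≤ qPochMajorant q s :=
  norm_qPochInf_le hq0 hq1 (by simpa [abs_of_nonneg hr] using hrs)

lemma continuous_qPochMajorant (hq0 : 0 < q) (hq1 : q < 1) : Continuous (qPochMajorant q) := by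
  have := continuous_qPochInf hq0 hq1
  unfold qPochMajorant
  fun_prop

lemma qPochMajorant_div (hq0 : 0 < q) (hq1 : q < 1) {r : ℝ} (hr : 0 ≤ r) :
    qPochMajorant q (r / q) = (1 + r / q) * qPochMajorant q r := by
  have hq : (q : ℂ) ≠ 0 := by exact_mod_cast hq0.ne'
  rw [qPochMajorant, qPochMajorant, qPochInf_eq_one_sub_mul hq0 hq1, norm_mul]
  congr 1
  · rw [show (1 : ℂ) - -((r / q : ℝ) : ℂ) = ((1 + r / q : ℝ) : ℂ) by push_cast; ring,
      Complex.norm_real, Real.norm_of_nonneg (by positivity)]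
  · congr 2
    push_cast
    field_simp

lemma askeyH_eq_qPochInf_mul (hq0 : 0 < q) (hq1 : q < 1) {y u v p : ℂ} (huv : u * v = 1)
    (hy : 2 * y = u + v) : askeyH q y p = qPochInf q (p * u) * qPochInf q (p * v) := by
  unfold askeyH qPochInf
  rw [← (multipliable_qPochInf hq0 hq1 _).tprod_mul (multipliable_qPochInf hq0 hq1 _)]
  refine tprod_congr fun k => ?_
  have : 2 * p * y = p * (u + v) := by rw [← hy]; ring
  rw [this, pow_mul', pow_two]
  linear_combination (-p ^ 2 * (q : ℂ) ^ k * (q : ℂ) ^ k) * huv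

lemma askeyH_I_mul_sinh (hq0 : 0 < q) (hq1 : q < 1) (t : ℝ) (p : ℂ) :
    askeyH q (Complex.I * Real.sinh t) p =
      qPochInf q (Complex.I * p * Real.exp t) * qPochInf q (-Complex.I * p * Real.exp (-t)) := by
  have h : (Real.exp t : ℂ) * Real.exp (-t) = 1 := by
    rw [← Complex.ofReal_mul, ← Real.exp_add]; simp
  rw [askeyH_eq_qPochInf_mul hq0 hq1 (u := Complex.I * Real.exp t)
    (v := -Complex.I * Real.exp (-t))]
  · ring_nf
  · linear_combination h - (Real.exp t : ℂ) * Real.exp (-t) * Complex.I_sq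
  · rw [Real.sinh_eq]; push_cast; ring

lemma askeyH_cosh_two_mul (hq0 : 0 < q) (hq1 : q < 1) (t : ℝ) :
    askeyH q (Real.cosh (2 * t) : ℂ) (-q) =
      qPochInf q (-((q * Real.exp t ^ 2 : ℝ) : ℂ)) *
        qPochInf q (-((q * Real.exp (-t) ^ 2 : ℝ) : ℂ)) := by
  have h : (Real.exp t : ℂ) * Real.exp (-t) = 1 := by
    rw [← Complex.ofReal_mul, ← Real.exp_add]; simp
  rw [askeyH_eq_qPochInf_mul hq0 hq1 (u := (Real.exp t : ℂ) ^ 2) (v := (Real.exp (-t) : ℂ) ^ 2)]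
  · push_cast; ring_nf
  · rw [← mul_pow, h, one_pow]
  · rw [Real.cosh_eq, ← Complex.ofReal_pow, ← Complex.ofReal_pow, ← Real.exp_nat_mul,
      ← Real.exp_nat_mul]
    push_cast; ring_nf

end qPochInf

/-! ### Integrable majorants for Askey weights. -/

section Integrability

/-- A nonnegative continuous function that eventually contracts by a factor `ρ < 1` under a
positive translation is integrable at infinity. -/
lemma integrableOn_Ioi_of_translate_le {f : ℝ → ℝ} {L ρ : ℝ} (hf : Continuous f)
    (hf0 : ∀ t, 0 ≤ f t) (hL : 0 < L) (hρ0 : 0 < ρ) (hρ1 : ρ < 1)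
    (h : ∀ᶠ t in atTop, f (t + L) ≤ ρ * f t) (a : ℝ) : IntegrableOn f (Set.Ioi a) := by
  -- The rate b satisfies e^{bL} = 1/ρ, so f(t)e^{bt} does not increase under t ↦ t + L once t ≥ T;
  -- its maximum over one period then bounds it on [T, ∞).
  set b := -Real.log ρ / L with hb
  have hb0 : 0 < b := div_pos (neg_pos.2 (Real.log_neg hρ0 hρ1)) hL
  obtain ⟨T, hT⟩ := eventually_atTop.1 h
  set g : ℝ → ℝ := fun t => f t * Real.exp (b * t) with hg
  have hgc : Continuous g := by fun_prop
  have hstep : ∀ t, T ≤ t → g (t + L) ≤ g t := by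
    intro t ht
    have e : Real.exp (b * (t + L)) = ρ⁻¹ * Real.exp (b * t) := by
      rw [mul_add, Real.exp_add, hb, div_mul_cancel₀ _ hL.ne', Real.exp_neg, Real.exp_log hρ0]
      ring
    calc g (t + L) = f (t + L) * (ρ⁻¹ * Real.exp (b * t)) := by rw [hg]; simp only [e]
      _ ≤ (ρ * f t) * (ρ⁻¹ * Real.exp (b * t)) := by gcongr; exact hT t ht
      _ = g t := by simp only [hg]; field_simp
  obtain ⟨K, hK⟩ := (isCompact_Icc (a := T) (b := T + L)).exists_bound_of_continuousOn
    hgc.continuousOn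
  have hind : ∀ n : ℕ, ∀ t, T + n * L ≤ t → t ≤ T + (n + 1) * L → g t ≤ K := by
    intro n
    induction n with
    | zero =>
      intro t h1 h2
      exact (le_abs_self _).trans (hK t ⟨by simpa using h1, by simpa using h2⟩)
    | succ n ih =>
      intro t h1 h2
      push_cast at h1 h2
      have h3 := hstep (t - L) (by nlinarith [Nat.cast_nonneg (α := ℝ) n])
      rw [sub_add_cancel] at h3
      exact h3.trans (ih (t - L) (by linarith) (by linarith))
  have hbound : ∀ t, T ≤ t → g t ≤ K := by
    intro t ht
    have h0 : 0 ≤ (t - T) / L := div_nonneg (sub_nonneg.2 ht) hL.le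
    have h1 := Nat.floor_le h0
    have h2 := (Nat.lt_floor_add_one ((t - T) / L)).le
    rw [le_div_iff₀ hL] at h1
    rw [div_le_iff₀ hL] at h2
    exact hind _ t (by linarith) (by linarith)
  refine integrable_of_isBigO_exp_neg hb0 hf.continuousOn ?_
  refine Asymptotics.IsBigO.of_bound K ?_
  filter_upwards [eventually_ge_atTop T] with t ht
  rw [Real.norm_of_nonneg (hf0 t), Real.norm_of_nonneg (Real.exp_pos _).le]
  have := hbound t ht
  rw [neg_mul, Real.exp_neg, ← div_eq_mul_inv, le_div_iff₀ (Real.exp_pos _)]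
  exact this

/-- The half-line factor `∏ (-rⱼ e^t;q)_∞ / (-q e^{2t};q)_∞` of the weight majorant. -/
noncomputable def halfMajorant (q r₁ r₂ r₃ r₄ t : ℝ) : ℝ :=
  qPochMajorant q (r₁ * Real.exp t) * qPochMajorant q (r₂ * Real.exp t) *
    qPochMajorant q (r₃ * Real.exp t) * qPochMajorant q (r₄ * Real.exp t) /
    qPochMajorant q (q * Real.exp t ^ 2)

/-- A majorant of all Askey weights whose parameters have moduli at most `rⱼ`. -/
noncomputable def weightMajorant (q r₁ r₂ r₃ r₄ t : ℝ) : ℝ :=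
  halfMajorant q r₁ r₂ r₃ r₄ t * halfMajorant q r₁ r₂ r₃ r₄ (-t)

variable {q r₁ r₂ r₃ r₄ : ℝ}

lemma halfMajorant_nonneg (t : ℝ) : 0 ≤ halfMajorant q r₁ r₂ r₃ r₄ t := by
  unfold halfMajorant qPochMajorant
  positivity

lemma continuous_halfMajorant (hq0 : 0 < q) (hq1 : q < 1) :
    Continuous (halfMajorant q r₁ r₂ r₃ r₄) := by
  have hc := continuous_qPochMajorant hq0 hq1
  unfold halfMajorant
  refine Continuous.div (by fun_prop) (by fun_prop) fun t => ?_
  exact (qPochMajorant_pos hq0 hq1 (by positivity)).ne'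

/-- The translation divides e^t by q. Each numerator product gains one factor; the denominator,
whose argument is divided by q², gains two. -/
lemma halfMajorant_add_log_inv (hq0 : 0 < q) (hq1 : q < 1) (h₁ : 0 ≤ r₁) (h₂ : 0 ≤ r₂)
    (h₃ : 0 ≤ r₃) (h₄ : 0 ≤ r₄) (t : ℝ) :
    halfMajorant q r₁ r₂ r₃ r₄ (t + Real.log q⁻¹) =
      ((1 + r₁ * Real.exp t / q) * (1 + r₂ * Real.exp t / q) * (1 + r₃ * Real.exp t / q) *
        (1 + r₄ * Real.exp t / q) / ((1 + Real.exp t ^ 2 / q) * (1 + Real.exp t ^ 2))) *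
        halfMajorant q r₁ r₂ r₃ r₄ t := by
  have hz : 0 < Real.exp t := Real.exp_pos t
  have hexp : Real.exp (t + Real.log q⁻¹) = Real.exp t / q := by
    rw [Real.exp_add, Real.exp_log (inv_pos.2 hq0), div_eq_mul_inv]
  have hd : qPochMajorant q (q * (Real.exp t / q) ^ 2) =
      (1 + Real.exp t ^ 2 / q) * ((1 + Real.exp t ^ 2) * qPochMajorant q (q * Real.exp t ^ 2)) := by
    have e1 : q * (Real.exp t / q) ^ 2 = Real.exp t ^ 2 / q := by field_simp
    have e2 : Real.exp t ^ 2 = q * Real.exp t ^ 2 / q := by field_simp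
    rw [e1, qPochMajorant_div hq0 hq1 (by positivity)]
    conv_lhs => rw [e2, qPochMajorant_div hq0 hq1 (by positivity), ← e2]
  have hpos := (qPochMajorant_pos hq0 hq1 (r := q * Real.exp t ^ 2) (by positivity)).ne'
  unfold halfMajorant
  rw [hexp, hd]
  simp only [← mul_div_assoc]
  rw [qPochMajorant_div hq0 hq1 (by positivity), qPochMajorant_div hq0 hq1 (by positivity),
    qPochMajorant_div hq0 hq1 (by positivity), qPochMajorant_div hq0 hq1 (by positivity)]
  field_simp

/-- Numerator and denominator both have formal degree 4 in z, so the ratio is a function of 1/z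
continuous at 0. Its limit being below 1 is the source of the condition on r₁r₂r₃r₄. -/
lemma tendsto_halfMajorant_ratio (hq0 : 0 < q) :
    Tendsto (fun z : ℝ => (1 + r₁ * z / q) * (1 + r₂ * z / q) * (1 + r₃ * z / q) *
      (1 + r₄ * z / q) / ((1 + z ^ 2 / q) * (1 + z ^ 2))) atTop
      (𝓝 (r₁ * r₂ * r₃ * r₄ / q ^ 3)) := by
  have hinv : Tendsto (fun z : ℝ => z⁻¹) atTop (𝓝 0) := tendsto_inv_atTop_zero
  have hcont : ContinuousAt (fun y : ℝ => (y + r₁ / q) * (y + r₂ / q) * (y + r₃ / q) *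
      (y + r₄ / q) / ((y ^ 2 + 1 / q) * (y ^ 2 + 1))) 0 := by
    refine ContinuousAt.div (by fun_prop) (by fun_prop) ?_
    positivity
  have := hcont.tendsto.comp hinv
  have e : (0 + r₁ / q) * (0 + r₂ / q) * (0 + r₃ / q) * (0 + r₄ / q) /
      (((0 : ℝ) ^ 2 + 1 / q) * (0 ^ 2 + 1)) = r₁ * r₂ * r₃ * r₄ / q ^ 3 := by
    field_simp; ring
  rw [e] at this
  refine this.congr' ?_
  filter_upwards [eventually_gt_atTop 0] with z hz
  simp only [Function.comp]
  field_simp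

lemma integrableOn_Ioi_halfMajorant (hq0 : 0 < q) (hq1 : q < 1) (h₁ : 0 ≤ r₁) (h₂ : 0 ≤ r₂)
    (h₃ : 0 ≤ r₃) (h₄ : 0 ≤ r₄) (hr : r₁ * r₂ * r₃ * r₄ < q ^ 3) (a : ℝ) :
    IntegrableOn (halfMajorant q r₁ r₂ r₃ r₄) (Set.Ioi a) := by
  have hlt : r₁ * r₂ * r₃ * r₄ / q ^ 3 < 1 := by rwa [div_lt_one (by positivity)]
  obtain ⟨ρ, hρ, hρ1⟩ := exists_between hlt
  have hρ0 : 0 < ρ := lt_of_le_of_lt (by positivity) hρ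
  refine integrableOn_Ioi_of_translate_le (continuous_halfMajorant hq0 hq1) halfMajorant_nonneg
    (Real.log_pos ((one_lt_inv₀ hq0).2 hq1)) hρ0 hρ1 ?_ a
  have := ((tendsto_halfMajorant_ratio (r₁ := r₁) (r₂ := r₂) (r₃ := r₃) (r₄ := r₄) hq0).comp
    Real.tendsto_exp_atTop).eventually_lt_const hρ
  filter_upwards [this] with t ht
  rw [halfMajorant_add_log_inv hq0 hq1 h₁ h₂ h₃ h₄]
  exact mul_le_mul_of_nonneg_right ht.le (halfMajorant_nonneg t)

lemma halfMajorant_le_of_nonpos (hq0 : 0 < q) (hq1 : q < 1) (h₁ : 0 ≤ r₁) (h₂ : 0 ≤ r₂)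
    (h₃ : 0 ≤ r₃) (h₄ : 0 ≤ r₄) {t : ℝ} (ht : t ≤ 0) :
    halfMajorant q r₁ r₂ r₃ r₄ t ≤ qPochMajorant q r₁ * qPochMajorant q r₂ *
      qPochMajorant q r₃ * qPochMajorant q r₄ := by
  have he : Real.exp t ≤ 1 := Real.exp_le_one_iff.2 ht
  have key : ∀ r, 0 ≤ r → qPochMajorant q (r * Real.exp t) ≤ qPochMajorant q r := fun r hr =>
    qPochMajorant_mono hq0 hq1 (by positivity) (mul_le_of_le_one_right hr he)
  have hn : ∀ r, 0 ≤ qPochMajorant q r := fun r => norm_nonneg _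
  refine (div_le_self (mul_nonneg (mul_nonneg (mul_nonneg (hn _) (hn _)) (hn _)) (hn _))
    (one_le_qPochMajorant hq0 hq1 (by positivity))).trans ?_
  exact mul_le_mul (mul_le_mul (mul_le_mul (key _ h₁) (key _ h₂) (hn _) (hn _)) (key _ h₃) (hn _)
    (mul_nonneg (hn _) (hn _))) (key _ h₄) (hn _) (mul_nonneg (mul_nonneg (hn _) (hn _)) (hn _))

lemma weightMajorant_neg (t : ℝ) :
    weightMajorant q r₁ r₂ r₃ r₄ (-t) = weightMajorant q r₁ r₂ r₃ r₄ t := by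
  rw [weightMajorant, weightMajorant, neg_neg, mul_comm]

lemma continuous_weightMajorant (hq0 : 0 < q) (hq1 : q < 1) :
    Continuous (weightMajorant q r₁ r₂ r₃ r₄) := by
  have := continuous_halfMajorant (r₁ := r₁) (r₂ := r₂) (r₃ := r₃) (r₄ := r₄) hq0 hq1
  unfold weightMajorant
  fun_prop

/-- For t > 0 the half factor at t is integrable and the one at -t is bounded; evenness gives the
other half-line. -/
lemma integrable_weightMajorant (hq0 : 0 < q) (hq1 : q < 1) (h₁ : 0 ≤ r₁) (h₂ : 0 ≤ r₂)
    (h₃ : 0 ≤ r₃) (h₄ : 0 ≤ r₄) (hr : r₁ * r₂ * r₃ * r₄ < q ^ 3) :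
    Integrable (weightMajorant q r₁ r₂ r₃ r₄) := by
  have hpos : IntegrableOn (weightMajorant q r₁ r₂ r₃ r₄) (Set.Ioi 0) := by
    refine ((integrableOn_Ioi_halfMajorant hq0 hq1 h₁ h₂ h₃ h₄ hr 0).mul_const
      (qPochMajorant q r₁ * qPochMajorant q r₂ * qPochMajorant q r₃ * qPochMajorant q r₄)).mono'
      (continuous_weightMajorant hq0 hq1).aestronglyMeasurable ?_
    filter_upwards [ae_restrict_mem measurableSet_Ioi] with t ht
    rw [weightMajorant, Real.norm_of_nonneg
      (mul_nonneg (halfMajorant_nonneg _) (halfMajorant_nonneg _))]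
    exact mul_le_mul_of_nonneg_left (halfMajorant_le_of_nonpos hq0 hq1 h₁ h₂ h₃ h₄
      (neg_nonpos.2 (le_of_lt ht))) (halfMajorant_nonneg _)
  have hneg : IntegrableOn (weightMajorant q r₁ r₂ r₃ r₄) (Set.Iio 0) := by
    have := IntegrableOn.comp_neg_Iio (c := (0 : ℝ)) (by simpa using hpos)
    simpa only [weightMajorant_neg] using this
  rw [← integrableOn_univ, ← Set.Iio_union_Ici (a := (0 : ℝ)), integrableOn_union,
    integrableOn_Ici_iff_integrableOn_Ioi]
  exact ⟨hneg, hpos⟩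

end Integrability

/-! ### The Askey weight, its translation law and the contiguous relation. -/

section AskeyWeight

/-- The weight `h(i sinh t;p₁,p₂,p₃,p₄) / h(cosh 2t;-q)` of Askey's integral. -/
noncomputable def askeyWeight (q : ℝ) (p₁ p₂ p₃ p₄ : ℂ) (t : ℝ) : ℂ :=
  askeyH q (Complex.I * Real.sinh t) p₁ * askeyH q (Complex.I * Real.sinh t) p₂ *
    askeyH q (Complex.I * Real.sinh t) p₃ * askeyH q (Complex.I * Real.sinh t) p₄ /
    askeyH q (Real.cosh (2 * t) : ℂ) (-q)

variable {q : ℝ} {p₁ p₂ p₃ p₄ : ℂ}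

lemma askeyH_cosh_ne_zero (hq0 : 0 < q) (hq1 : q < 1) (t : ℝ) :
    askeyH q (Real.cosh (2 * t) : ℂ) (-q) ≠ 0 := by
  rw [askeyH_cosh_two_mul hq0 hq1]
  exact mul_ne_zero (qPochInf_neg_ofReal_ne_zero hq0 hq1 (by positivity))
    (qPochInf_neg_ofReal_ne_zero hq0 hq1 (by positivity))

lemma continuous_askeyH_sinh (hq0 : 0 < q) (hq1 : q < 1) (p : ℂ) :
    Continuous fun t : ℝ => askeyH q (Complex.I * Real.sinh t) p := by
  have := continuous_qPochInf hq0 hq1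
  simp only [askeyH_I_mul_sinh hq0 hq1]
  fun_prop

lemma continuous_askeyWeight (hq0 : 0 < q) (hq1 : q < 1) :
    Continuous (askeyWeight q p₁ p₂ p₃ p₄) := by
  have h := continuous_qPochInf hq0 hq1
  have hs := continuous_askeyH_sinh hq0 hq1
  have hc : Continuous fun t : ℝ => askeyH q (Real.cosh (2 * t) : ℂ) (-q) := by
    simp only [askeyH_cosh_two_mul hq0 hq1]
    fun_prop
  exact ((((hs p₁).mul (hs p₂)).mul (hs p₃)).mul (hs p₄)).div hc (askeyH_cosh_ne_zero hq0 hq1)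

lemma norm_askeyH_sinh_le (hq0 : 0 < q) (hq1 : q < 1) {p : ℂ} {r : ℝ} (hp : ‖p‖ ≤ r) (t : ℝ) :
    ‖askeyH q (Complex.I * Real.sinh t) p‖ ≤
      qPochMajorant q (r * Real.exp t) * qPochMajorant q (r * Real.exp (-t)) := by
  rw [askeyH_I_mul_sinh hq0 hq1, norm_mul]
  refine mul_le_mul (norm_qPochInf_le hq0 hq1 ?_) (norm_qPochInf_le hq0 hq1 ?_)
    (norm_nonneg _) (norm_nonneg _)
  · rw [norm_mul, norm_mul, Complex.norm_I, one_mul, Complex.norm_real,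
      Real.norm_of_nonneg (Real.exp_pos _).le]
    gcongr
  · rw [norm_mul, norm_mul, norm_neg, Complex.norm_I, one_mul, Complex.norm_real,
      Real.norm_of_nonneg (Real.exp_pos _).le]
    gcongr

lemma weightMajorant_eq (hq0 : 0 < q) (hq1 : q < 1) (r₁ r₂ r₃ r₄ t : ℝ) :
    weightMajorant q r₁ r₂ r₃ r₄ t =
      (qPochMajorant q (r₁ * Real.exp t) * qPochMajorant q (r₁ * Real.exp (-t))) *
      (qPochMajorant q (r₂ * Real.exp t) * qPochMajorant q (r₂ * Real.exp (-t))) *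
      (qPochMajorant q (r₃ * Real.exp t) * qPochMajorant q (r₃ * Real.exp (-t))) *
      (qPochMajorant q (r₄ * Real.exp t) * qPochMajorant q (r₄ * Real.exp (-t))) /
      ‖askeyH q (Real.cosh (2 * t) : ℂ) (-q)‖ := by
  rw [askeyH_cosh_two_mul hq0 hq1, norm_mul, weightMajorant, halfMajorant, halfMajorant,
    div_mul_div_comm]
  congr 1
  ring

lemma norm_askeyWeight_le (hq0 : 0 < q) (hq1 : q < 1) {r₁ r₂ r₃ r₄ : ℝ} (h₁ : ‖p₁‖ ≤ r₁)
    (h₂ : ‖p₂‖ ≤ r₂) (h₃ : ‖p₃‖ ≤ r₃) (h₄ : ‖p₄‖ ≤ r₄) (t : ℝ) :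
    ‖askeyWeight q p₁ p₂ p₃ p₄ t‖ ≤ weightMajorant q r₁ r₂ r₃ r₄ t := by
  rw [weightMajorant_eq hq0 hq1, askeyWeight, norm_div, norm_mul, norm_mul, norm_mul]
  have hn : ∀ r, 0 ≤ qPochMajorant q r := fun r => norm_nonneg _
  have hn' : ∀ r s, 0 ≤ qPochMajorant q r * qPochMajorant q s := fun r s =>
    mul_nonneg (hn r) (hn s)
  refine div_le_div_of_nonneg_right ?_ (norm_nonneg _)
  exact mul_le_mul (mul_le_mul (mul_le_mul (norm_askeyH_sinh_le hq0 hq1 h₁ t)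
    (norm_askeyH_sinh_le hq0 hq1 h₂ t) (norm_nonneg _) (hn' _ _))
    (norm_askeyH_sinh_le hq0 hq1 h₃ t) (norm_nonneg _) (mul_nonneg (hn' _ _) (hn' _ _)))
    (norm_askeyH_sinh_le hq0 hq1 h₄ t) (norm_nonneg _)
    (mul_nonneg (mul_nonneg (hn' _ _) (hn' _ _)) (hn' _ _))

lemma integrable_weightMajorant_norm (hq0 : 0 < q) (hq1 : q < 1)
    (hp : ‖p₁ * p₂ * p₃ * p₄‖ < q ^ 3) :
    Integrable (weightMajorant q ‖p₁‖ ‖p₂‖ ‖p₃‖ ‖p₄‖) :=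
  integrable_weightMajorant hq0 hq1 (norm_nonneg _) (norm_nonneg _) (norm_nonneg _)
    (norm_nonneg _) (by simpa using hp)

lemma integrable_askeyWeight (hq0 : 0 < q) (hq1 : q < 1) (hp : ‖p₁ * p₂ * p₃ * p₄‖ < q ^ 3) :
    Integrable (askeyWeight q p₁ p₂ p₃ p₄) :=
  (integrable_weightMajorant_norm hq0 hq1 hp).mono'
    (continuous_askeyWeight hq0 hq1).aestronglyMeasurable
    (.of_forall (norm_askeyWeight_le hq0 hq1 le_rfl le_rfl le_rfl le_rfl))

lemma askeyH_sinh_eq_mul (hq0 : 0 < q) (hq1 : q < 1) (p : ℂ) (t : ℝ) :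
    askeyH q (Complex.I * Real.sinh t) p =
      (1 - Complex.I * p * Real.exp t) * (1 + Complex.I * p * (Real.exp t : ℂ)⁻¹) *
        askeyH q (Complex.I * Real.sinh t) (q * p) := by
  rw [askeyH_I_mul_sinh hq0 hq1, askeyH_I_mul_sinh hq0 hq1,
    qPochInf_eq_one_sub_mul hq0 hq1 (Complex.I * p * Real.exp t),
    qPochInf_eq_one_sub_mul hq0 hq1 (-Complex.I * p * Real.exp (-t)), Real.exp_neg,
    Complex.ofReal_inv]
  ring_nf

lemma exp_add_log_inv (hq0 : 0 < q) (t : ℝ) :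
    Real.exp (t + Real.log q⁻¹) = Real.exp t / q := by
  rw [Real.exp_add, Real.exp_log (inv_pos.2 hq0), div_eq_mul_inv]

lemma exp_neg_add_log_inv (hq0 : 0 < q) (t : ℝ) :
    Real.exp (-(t + Real.log q⁻¹)) = Real.exp (-t) * q := by
  rw [Real.exp_neg, exp_add_log_inv hq0, Real.exp_neg, inv_div, div_eq_mul_inv, mul_comm]

/-- One factor moves between the two products of h. The relation is kept free of division because 1
+ ipe^{-t} can vanish for complex p. -/
lemma askeyH_sinh_shift (hq0 : 0 < q) (hq1 : q < 1) (p : ℂ) (t : ℝ) :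
    askeyH q (Complex.I * Real.sinh (t + Real.log q⁻¹)) p *
        (1 + Complex.I * p * (Real.exp t : ℂ)⁻¹) =
      askeyH q (Complex.I * Real.sinh t) p * (1 - Complex.I * p * Real.exp t / q) := by
  have hq : (q : ℂ) ≠ 0 := by exact_mod_cast hq0.ne'
  rw [askeyH_I_mul_sinh hq0 hq1, askeyH_I_mul_sinh hq0 hq1, exp_add_log_inv hq0,
    exp_neg_add_log_inv hq0,
    qPochInf_eq_one_sub_mul hq0 hq1 (-Complex.I * p * Real.exp (-t)),
    qPochInf_eq_one_sub_mul hq0 hq1 (Complex.I * p * (Real.exp t / q : ℝ))]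
  have e : Complex.I * p * ((Real.exp t / q : ℝ) : ℂ) * q = Complex.I * p * Real.exp t := by
    push_cast; field_simp
  rw [e, Real.exp_neg]
  push_cast
  ring_nf

lemma askeyH_cosh_shift (hq0 : 0 < q) (hq1 : q < 1) (t : ℝ) :
    askeyH q (Real.cosh (2 * (t + Real.log q⁻¹)) : ℂ) (-q) *
        ((1 + q * (Real.exp t : ℂ)⁻¹ ^ 2) * (1 + q ^ 2 * (Real.exp t : ℂ)⁻¹ ^ 2)) =
      askeyH q (Real.cosh (2 * t) : ℂ) (-q) *
        ((1 + (Real.exp t : ℂ) ^ 2 / q) * (1 + (Real.exp t : ℂ) ^ 2)) := by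
  have hq : (q : ℂ) ≠ 0 := by exact_mod_cast hq0.ne'
  have hz : (Real.exp t : ℂ) ≠ 0 := by exact_mod_cast (Real.exp_pos t).ne'
  rw [askeyH_cosh_two_mul hq0 hq1, askeyH_cosh_two_mul hq0 hq1, exp_add_log_inv hq0,
    exp_neg_add_log_inv hq0, Real.exp_neg,
    qPochInf_eq_one_sub_mul hq0 hq1 (-((q * (Real.exp t)⁻¹ ^ 2 : ℝ) : ℂ)),
    qPochInf_eq_one_sub_mul hq0 hq1 (-((q * (Real.exp t)⁻¹ ^ 2 : ℝ) : ℂ) * q),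
    qPochInf_eq_one_sub_mul hq0 hq1 (-((q * (Real.exp t / q) ^ 2 : ℝ) : ℂ)),
    qPochInf_eq_one_sub_mul hq0 hq1 (-((q * (Real.exp t / q) ^ 2 : ℝ) : ℂ) * q)]
  have e1 : -((q * (Real.exp t / q) ^ 2 : ℝ) : ℂ) * q * q = -((q * Real.exp t ^ 2 : ℝ) : ℂ) := by
    push_cast; field_simp
  have e2 : -((q * ((Real.exp t)⁻¹ * q) ^ 2 : ℝ) : ℂ) =
      -((q * (Real.exp t)⁻¹ ^ 2 : ℝ) : ℂ) * q * q := by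
    push_cast; ring
  rw [e1, e2]
  push_cast
  field_simp
  ring

/-- The function whose difference under the translation by `log q⁻¹` gives the first-order
relation between moments of the Askey weight. -/
noncomputable def askeyTelescoper (q : ℝ) (p₁ p₂ p₃ p₄ : ℂ) (t : ℝ) : ℂ :=
  askeyWeight q p₁ p₂ p₃ p₄ t *
    ((1 + Complex.I * p₁ / (q * Real.exp t)) * (1 + Complex.I * p₂ / (q * Real.exp t)) *
      (1 + Complex.I * p₃ / (q * Real.exp t)) * (1 + Complex.I * p₄ / (q * Real.exp t)) *
      (Real.exp t ^ 3 / (1 + Real.exp t ^ 2)))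

/-- With z = e^t and sⱼ = ipⱼ, the difference reduces to ∏(1 - sⱼz/q) - ∏(z + sⱼ/q) over z(1 + z²).
The second elementary symmetric function cancels and every other contribution is divisible by 1 +
z², so only z⁻¹ - z and a constant survive. -/
lemma askeyTelescoper_shift_sub (hq0 : 0 < q) (hq1 : q < 1) (t : ℝ) :
    askeyTelescoper q p₁ p₂ p₃ p₄ (t + Real.log q⁻¹) - askeyTelescoper q p₁ p₂ p₃ p₄ t =
      askeyWeight q p₁ p₂ p₃ p₄ t *
        ((1 - p₁ * p₂ * p₃ * p₄ / q ^ 4) * ((Real.exp t : ℂ)⁻¹ - Real.exp t) -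
          Complex.I * ((p₁ + p₂ + p₃ + p₄) / q -
            (p₁ * p₂ * p₃ + p₁ * p₂ * p₄ + p₁ * p₃ * p₄ + p₂ * p₃ * p₄) / q ^ 3)) := by
  have hq : (q : ℂ) ≠ 0 := by exact_mod_cast hq0.ne'
  have hz : (Real.exp t : ℂ) ≠ 0 := by exact_mod_cast (Real.exp_pos t).ne'
  have hz2 : (1 + (Real.exp t : ℂ) ^ 2) ≠ 0 := by
    exact_mod_cast (by positivity : (1 + Real.exp t ^ 2) ≠ 0)
  have hz3 : ((q : ℂ) ^ 2 + (Real.exp t : ℂ) ^ 2) ≠ 0 := by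
    exact_mod_cast (by positivity : (q ^ 2 + Real.exp t ^ 2) ≠ 0)
  have hz4 : ((q : ℂ) + (Real.exp t : ℂ) ^ 2) ≠ 0 := by
    exact_mod_cast (by positivity : (q + Real.exp t ^ 2) ≠ 0)
  have hd := askeyH_cosh_ne_zero hq0 hq1 t
  have hd' := askeyH_cosh_ne_zero hq0 hq1 (t + Real.log q⁻¹)
  have k₁ := askeyH_sinh_shift hq0 hq1 p₁ t
  have k₂ := askeyH_sinh_shift hq0 hq1 p₂ t
  have k₃ := askeyH_sinh_shift hq0 hq1 p₃ t
  have k₄ := askeyH_sinh_shift hq0 hq1 p₄ t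
  have k₅ := askeyH_cosh_shift hq0 hq1 t
  rw [askeyTelescoper, askeyTelescoper, askeyWeight, askeyWeight, exp_add_log_inv hq0]
  generalize askeyH q (Real.cosh (2 * (t + Real.log q⁻¹)) : ℂ) (-q) = D' at *
  generalize askeyH q (Real.cosh (2 * t) : ℂ) (-q) = D at *
  generalize askeyH q (Complex.I * Real.sinh (t + Real.log q⁻¹)) p₁ = A₁' at *
  generalize askeyH q (Complex.I * Real.sinh (t + Real.log q⁻¹)) p₂ = A₂' at *
  generalize askeyH q (Complex.I * Real.sinh (t + Real.log q⁻¹)) p₃ = A₃' at *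
  generalize askeyH q (Complex.I * Real.sinh (t + Real.log q⁻¹)) p₄ = A₄' at *
  generalize askeyH q (Complex.I * Real.sinh t) p₁ = A₁ at *
  generalize askeyH q (Complex.I * Real.sinh t) p₂ = A₂ at *
  generalize askeyH q (Complex.I * Real.sinh t) p₃ = A₃ at *
  generalize askeyH q (Complex.I * Real.sinh t) p₄ = A₄ at *
  simp only [Complex.ofReal_div]
  generalize (Real.exp t : ℂ) = z at *
  -- The factor q + z² is common to both sides of `k₅` and is cancelled.
  have hD : D' * (q * (q ^ 2 + z ^ 2)) = z ^ 4 * (1 + z ^ 2) * D := by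
    refine mul_right_cancel₀ hz4 ?_
    field_simp at k₅
    linear_combination k₅
  have hprod : A₁' * A₂' * A₃' * A₄' / D' *
      ((1 + Complex.I * p₁ / (q * (z / q))) * (1 + Complex.I * p₂ / (q * (z / q))) *
        (1 + Complex.I * p₃ / (q * (z / q))) * (1 + Complex.I * p₄ / (q * (z / q))) *
        ((z / q) ^ 3 / (1 + (z / q) ^ 2))) =
      A₁ * A₂ * A₃ * A₄ / D * ((1 - Complex.I * p₁ * z / q) * (1 - Complex.I * p₂ * z / q) *
        (1 - Complex.I * p₃ * z / q) * (1 - Complex.I * p₄ * z / q) / (z * (1 + z ^ 2))) := by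
    have e : q * (z / q) = z := by field_simp
    have hDinv : (D')⁻¹ = q * (q ^ 2 + z ^ 2) / (z ^ 4 * (1 + z ^ 2) * D) := by
      rw [← hD]; field_simp
    calc _ = (A₁' * (1 + Complex.I * p₁ * z⁻¹)) * (A₂' * (1 + Complex.I * p₂ * z⁻¹)) *
          (A₃' * (1 + Complex.I * p₃ * z⁻¹)) * (A₄' * (1 + Complex.I * p₄ * z⁻¹)) *
          ((D')⁻¹ * ((z / q) ^ 3 / (1 + (z / q) ^ 2))) := by rw [e]; ring
      _ = _ := by
        rw [k₁, k₂, k₃, k₄, hDinv,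
          show (1 + (z / q) ^ 2) = (q ^ 2 + z ^ 2) / q ^ 2 by field_simp]
        field_simp
  rw [hprod, ← mul_sub]
  congr 1
  have hI3 : Complex.I ^ 3 = -Complex.I := by rw [pow_succ, Complex.I_sq]; ring
  have hI4 : Complex.I ^ 4 = 1 := Complex.I_pow_four
  have hs : ∀ s₁ s₂ s₃ s₄ : ℂ,
      (1 - s₁ * z / q) * (1 - s₂ * z / q) * (1 - s₃ * z / q) * (1 - s₄ * z / q) /
          (z * (1 + z ^ 2)) -
        (1 + s₁ / (q * z)) * (1 + s₂ / (q * z)) * (1 + s₃ / (q * z)) * (1 + s₄ / (q * z)) *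
          (z ^ 3 / (1 + z ^ 2)) =
      (1 - s₁ * s₂ * s₃ * s₄ / q ^ 4) * (z⁻¹ - z) - ((s₁ + s₂ + s₃ + s₄) / q +
        (s₁ * s₂ * s₃ + s₁ * s₂ * s₄ + s₁ * s₃ * s₄ + s₂ * s₃ * s₄) / q ^ 3) := by
    intro s₁ s₂ s₃ s₄
    field_simp
    ring
  rw [hs]
  linear_combination (-p₁ * p₂ * p₃ * p₄ / q ^ 4 * (z⁻¹ - z)) * hI4 -
    ((p₁ * p₂ * p₃ + p₁ * p₂ * p₄ + p₁ * p₃ * p₄ + p₂ * p₃ * p₄) / q ^ 3) * hI3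

lemma continuous_askeyTelescoper (hq0 : 0 < q) (hq1 : q < 1) :
    Continuous (askeyTelescoper q p₁ p₂ p₃ p₄) := by
  have h := continuous_askeyWeight (p₁ := p₁) (p₂ := p₂) (p₃ := p₃) (p₄ := p₄) hq0 hq1
  have hz : ∀ t : ℝ, (q : ℂ) * (Real.exp t : ℂ) ≠ 0 := fun t => by
    exact_mod_cast (by positivity : q * Real.exp t ≠ 0)
  have hz2 : ∀ t : ℝ, (1 + (Real.exp t : ℂ) ^ 2) ≠ 0 := fun t => by
    exact_mod_cast (by positivity : (1 + Real.exp t ^ 2) ≠ 0)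
  unfold askeyTelescoper
  refine h.mul (.mul (.mul (.mul (.mul ?_ ?_) ?_) ?_) ?_)
  all_goals first
    | exact continuous_const.add (continuous_const.div (by fun_prop) hz)
    | exact Continuous.div (by fun_prop) (by fun_prop) hz2

lemma qPochMajorant_eq_mul (hq0 : 0 < q) (hq1 : q < 1) {r : ℝ} (hr : 0 ≤ r) :
    qPochMajorant q r = (1 + r) * qPochMajorant q (q * r) := by
  have := qPochMajorant_div hq0 hq1 (r := q * r) (by positivity)
  rwa [mul_div_cancel_left₀ _ hq0.ne'] at this

lemma weightMajorant_eq_mul (hq0 : 0 < q) (hq1 : q < 1) {r₁ r₂ r₃ r₄ : ℝ} (h₁ : 0 ≤ r₁)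
    (t : ℝ) : weightMajorant q r₁ r₂ r₃ r₄ t =
      (1 + r₁ * Real.exp t) * (1 + r₁ * Real.exp (-t)) *
        weightMajorant q (q * r₁) r₂ r₃ r₄ t := by
  rw [weightMajorant_eq hq0 hq1, weightMajorant_eq hq0 hq1,
    qPochMajorant_eq_mul hq0 hq1 (r := r₁ * Real.exp t) (by positivity),
    qPochMajorant_eq_mul hq0 hq1 (r := r₁ * Real.exp (-t)) (by positivity)]
  ring_nf

/-- Lowering p₁ to qp₁ frees the factor (1 + |p₁|e^t)(1 + |p₁|e^{-t}) of the majorant, which pays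
for one extra moment e^t + e^{-t}. -/
lemma norm_askeyWeight_mul_le (hq0 : 0 < q) (hq1 : q < 1) (t : ℝ) :
    ‖p₁‖ * (Real.exp t + (Real.exp t)⁻¹) * ‖askeyWeight q (q * p₁) p₂ p₃ p₄ t‖ ≤
      weightMajorant q ‖p₁‖ ‖p₂‖ ‖p₃‖ ‖p₄‖ t := by
  rw [weightMajorant_eq_mul hq0 hq1 (norm_nonneg p₁)]
  have h := norm_askeyWeight_le hq0 hq1 (p₁ := q * p₁) (p₂ := p₂) (p₃ := p₃) (p₄ := p₄)
    (r₁ := q * ‖p₁‖) (by simp [abs_of_pos hq0]) le_rfl le_rfl le_rfl t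
  have hz := Real.exp_pos t
  refine mul_le_mul ?_ h (norm_nonneg _) (by positivity)
  rw [Real.exp_neg]
  have : Real.exp t * (Real.exp t)⁻¹ = 1 := mul_inv_cancel₀ hz.ne'
  nlinarith [norm_nonneg p₁, sq_nonneg ‖p₁‖]

lemma norm_telescoper_factor_le (hq0 : 0 < q) (p : ℂ) (t : ℝ) :
    ‖1 + Complex.I * p / (q * Real.exp t)‖ ≤ (1 + ‖p‖ / q) * (1 + (Real.exp t)⁻¹) := by
  have hz := Real.exp_pos t
  refine (norm_add_le _ _).trans ?_
  rw [norm_one, norm_div, norm_mul, norm_mul, Complex.norm_I, one_mul, Complex.norm_real,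
    Complex.norm_real, Real.norm_of_nonneg hq0.le, Real.norm_of_nonneg hz.le, ← div_div]
  have : 0 ≤ ‖p‖ / q := by positivity
  have : 0 < (Real.exp t)⁻¹ := by positivity
  rw [div_eq_mul_inv (‖p‖ / q)]
  nlinarith

/-- The rational factor of the telescoper is O(e^t + e^{-t}). The first parameter is qp₁ with p₁ ≠ 0
so that `norm_askeyWeight_mul_le` absorbs this growth. -/
lemma integrable_askeyTelescoper (hq0 : 0 < q) (hq1 : q < 1) (hp₁ : p₁ ≠ 0)
    (hp : ‖p₁ * p₂ * p₃ * p₄‖ < q ^ 3) : Integrable (askeyTelescoper q (q * p₁) p₂ p₃ p₄) := by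
  set C : ℝ := (1 + ‖q * p₁‖ / q) * (1 + ‖p₂‖ / q) * (1 + ‖p₃‖ / q) * (1 + ‖p₄‖ / q) with hC
  refine ((integrable_weightMajorant_norm hq0 hq1 hp).const_mul (4 * C / ‖p₁‖)).mono'
    (continuous_askeyTelescoper hq0 hq1).aestronglyMeasurable (.of_forall fun t => ?_)
  have hn : 0 < ‖p₁‖ := norm_pos_iff.2 hp₁
  have hz := Real.exp_pos t
  have hC0 : 0 ≤ C := by positivity
  have hlast : ‖((Real.exp t : ℂ) ^ 3 / (1 + (Real.exp t : ℂ) ^ 2))‖ =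
      Real.exp t ^ 3 / (1 + Real.exp t ^ 2) := by
    rw [← Complex.ofReal_pow, ← Complex.ofReal_pow, ← Complex.ofReal_one, ← Complex.ofReal_add,
      ← Complex.ofReal_div, Complex.norm_real, Real.norm_of_nonneg (by positivity)]
  have hpoly : (1 + (Real.exp t)⁻¹) ^ 4 * (Real.exp t ^ 3 / (1 + Real.exp t ^ 2)) ≤
      4 * (Real.exp t + (Real.exp t)⁻¹) := by
    generalize Real.exp t = z at hz ⊢
    have h2 : (1 + z) ^ 2 ≤ 2 * (1 + z ^ 2) := by nlinarith [sq_nonneg (1 - z)]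
    have h4 : (1 + z) ^ 4 ≤ 4 * (1 + z ^ 2) ^ 2 := by
      calc (1 + z) ^ 4 = ((1 + z) ^ 2) ^ 2 := by ring
        _ ≤ (2 * (1 + z ^ 2)) ^ 2 := by gcongr
        _ = _ := by ring
    have e1 : (1 + z⁻¹) ^ 4 * (z ^ 3 / (1 + z ^ 2)) = (1 + z) ^ 4 / (z * (1 + z ^ 2)) := by
      field_simp
      ring
    have e2 : 4 * (z + z⁻¹) = 4 * (1 + z ^ 2) ^ 2 / (z * (1 + z ^ 2)) := by
      field_simp
      ring
    rw [e1, e2]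
    gcongr
  have hfac : ‖(1 + Complex.I * (q * p₁) / (q * Real.exp t)) *
      (1 + Complex.I * p₂ / (q * Real.exp t)) * (1 + Complex.I * p₃ / (q * Real.exp t)) *
      (1 + Complex.I * p₄ / (q * Real.exp t)) *
      ((Real.exp t : ℂ) ^ 3 / (1 + (Real.exp t : ℂ) ^ 2))‖ ≤
      C * (4 * (Real.exp t + (Real.exp t)⁻¹)) := by
    rw [norm_mul, norm_mul, norm_mul, norm_mul, hlast]
    calc _ ≤ (((1 + ‖q * p₁‖ / q) * (1 + (Real.exp t)⁻¹)) *
          ((1 + ‖p₂‖ / q) * (1 + (Real.exp t)⁻¹)) * ((1 + ‖p₃‖ / q) * (1 + (Real.exp t)⁻¹)) *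
          ((1 + ‖p₄‖ / q) * (1 + (Real.exp t)⁻¹))) *
          (Real.exp t ^ 3 / (1 + Real.exp t ^ 2)) := by
            gcongr <;> exact norm_telescoper_factor_le hq0 _ t
      _ = C * ((1 + (Real.exp t)⁻¹) ^ 4 * (Real.exp t ^ 3 / (1 + Real.exp t ^ 2))) := by
            rw [hC]; ring
      _ ≤ _ := by gcongr
  rw [askeyTelescoper, norm_mul]
  calc _ ≤ ‖askeyWeight q (q * p₁) p₂ p₃ p₄ t‖ * (C * (4 * (Real.exp t + (Real.exp t)⁻¹))) := by
        gcongr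
    _ = 4 * C / ‖p₁‖ * (‖p₁‖ * (Real.exp t + (Real.exp t)⁻¹) *
          ‖askeyWeight q (q * p₁) p₂ p₃ p₄ t‖) := by field_simp
    _ ≤ _ := by gcongr; exact norm_askeyWeight_mul_le hq0 hq1 t

/-- The contiguous relation for Askey's integral. -/
lemma integral_askeyWeight_contiguous (hq0 : 0 < q) (hq1 : q < 1)
    (hp : ‖p₁ * p₂ * p₃ * p₄‖ < q ^ 3) :
    (1 - p₁ * p₂ * p₃ * p₄ / q ^ 3) * ∫ t, askeyWeight q p₁ p₂ p₃ p₄ t =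
      (1 - p₁ * p₂ / q) * (1 - p₁ * p₃ / q) * (1 - p₁ * p₄ / q) *
        ∫ t, askeyWeight q (q * p₁) p₂ p₃ p₄ t := by
  -- For p₁ = 0 both sides are the same integral; otherwise the telescoper is integrable.
  rcases eq_or_ne p₁ 0 with rfl | hp₁
  · simp
  have hq : (q : ℂ) ≠ 0 := by exact_mod_cast hq0.ne'
  have hp' : ‖q * p₁ * p₂ * p₃ * p₄‖ < q ^ 3 := by
    rw [show q * p₁ * p₂ * p₃ * p₄ = q * (p₁ * p₂ * p₃ * p₄) by ring, norm_mul,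
      Complex.norm_real, Real.norm_of_nonneg hq0.le]
    nlinarith [norm_nonneg (p₁ * p₂ * p₃ * p₄)]
  have hW := integrable_askeyWeight hq0 hq1 hp
  have hW' := integrable_askeyWeight hq0 hq1 hp'
  have hG := integrable_askeyTelescoper hq0 hq1 hp₁ hp
  have hzero : ∫ t, (askeyTelescoper q (q * p₁) p₂ p₃ p₄ (t + Real.log q⁻¹) -
      askeyTelescoper q (q * p₁) p₂ p₃ p₄ t) = 0 := by
    rw [integral_sub (hG.comp_add_right _) hG, integral_add_right_eq_self, sub_self]
  -- The weight for p₁ is 1 + p₁² + ip₁(z⁻¹ - z) times the weight for qp₁. Multiplying the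
  -- telescoped difference by ip₁ therefore eliminates the moment z⁻¹ - z.
  have hrel : ∀ t, Complex.I * p₁ * (askeyTelescoper q (q * p₁) p₂ p₃ p₄ (t + Real.log q⁻¹) -
      askeyTelescoper q (q * p₁) p₂ p₃ p₄ t) =
      (1 - p₁ * p₂ * p₃ * p₄ / q ^ 3) * askeyWeight q p₁ p₂ p₃ p₄ t -
      (1 - p₁ * p₂ / q) * (1 - p₁ * p₃ / q) * (1 - p₁ * p₄ / q) *
        askeyWeight q (q * p₁) p₂ p₃ p₄ t := by
    intro t
    have hz : (Real.exp t : ℂ) ≠ 0 := by exact_mod_cast (Real.exp_pos t).ne'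
    have e : askeyWeight q p₁ p₂ p₃ p₄ t =
        (1 - Complex.I * p₁ * Real.exp t) * (1 + Complex.I * p₁ * (Real.exp t : ℂ)⁻¹) *
          askeyWeight q (q * p₁) p₂ p₃ p₄ t := by
      rw [askeyWeight, askeyH_sinh_eq_mul hq0 hq1 p₁, askeyWeight]
      ring
    rw [askeyTelescoper_shift_sub hq0 hq1, e]
    generalize askeyWeight q (q * p₁) p₂ p₃ p₄ t = W
    generalize (Real.exp t : ℂ) = z at *
    field_simp
    ring_nf
    simp only [Complex.I_sq]
    ring
  have hint : ∫ t, ((1 - p₁ * p₂ * p₃ * p₄ / q ^ 3) * askeyWeight q p₁ p₂ p₃ p₄ t -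
      (1 - p₁ * p₂ / q) * (1 - p₁ * p₃ / q) * (1 - p₁ * p₄ / q) *
        askeyWeight q (q * p₁) p₂ p₃ p₄ t) = 0 := by
    simp_rw [← hrel]
    rw [integral_const_mul, hzero, mul_zero]
  rw [integral_sub (hW.const_mul _) (hW'.const_mul _), integral_const_mul,
    integral_const_mul] at hint
  exact sub_eq_zero.1 hint

end AskeyWeight

/-! ### Evaluation of Askey's integral. -/

section AskeyIntegral

variable {q : ℝ} {p₁ p₂ p₃ p₄ : ℂ}

lemma tendsto_qPoch (hq0 : 0 < q) (hq1 : q < 1) (a : ℂ) :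
    Tendsto (qPoch q a) atTop (𝓝 (qPochInf q a)) :=
  (multipliable_qPochInf hq0 hq1 a).hasProd.tendsto_prod_nat

lemma continuous_askeyH_param (hq0 : 0 < q) (hq1 : q < 1) (t : ℝ) :
    Continuous fun p : ℂ => askeyH q (Complex.I * Real.sinh t) p := by
  have := continuous_qPochInf hq0 hq1
  simp only [askeyH_I_mul_sinh hq0 hq1]
  fun_prop

lemma norm_pow_mul_le (hq0 : 0 < q) (hq1 : q < 1) (p : ℂ) (n : ℕ) : ‖(q : ℂ) ^ n * p‖ ≤ ‖p‖ := by
  rw [norm_mul, norm_pow, Complex.norm_real, Real.norm_of_nonneg hq0.le]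
  exact mul_le_of_le_one_left (norm_nonneg _) (pow_le_one₀ hq0.le hq1.le)

lemma norm_pow_mul_prod_lt (hq0 : 0 < q) (hq1 : q < 1) (hp : ‖p₁ * p₂ * p₃ * p₄‖ < q ^ 3)
    (n : ℕ) : ‖(q : ℂ) ^ n * p₁ * p₂ * p₃ * p₄‖ < q ^ 3 := by
  rw [show (q : ℂ) ^ n * p₁ * p₂ * p₃ * p₄ = q ^ n * (p₁ * p₂ * p₃ * p₄) by ring]
  exact (norm_pow_mul_le hq0 hq1 _ n).trans_lt hp

lemma tendsto_pow_mul (hq0 : 0 < q) (hq1 : q < 1) (p : ℂ) :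
    Tendsto (fun n : ℕ => (q : ℂ) ^ n * p) atTop (𝓝 0) := by
  have h : ‖(q : ℂ)‖ < 1 := by rwa [Complex.norm_real, Real.norm_of_nonneg hq0.le]
  simpa using (tendsto_pow_atTop_nhds_zero_of_norm_lt_one h).mul_const p

/-- Dominated convergence: the majorant built from |p₁| serves for every q^n p₁. -/
lemma tendsto_integral_askeyWeight (hq0 : 0 < q) (hq1 : q < 1)
    (hp : ‖p₁ * p₂ * p₃ * p₄‖ < q ^ 3) :
    Tendsto (fun n : ℕ => ∫ t, askeyWeight q ((q : ℂ) ^ n * p₁) p₂ p₃ p₄ t) atTop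
      (𝓝 (∫ t, askeyWeight q 0 p₂ p₃ p₄ t)) := by
  refine tendsto_integral_of_dominated_convergence (weightMajorant q ‖p₁‖ ‖p₂‖ ‖p₃‖ ‖p₄‖)
    (fun n => (continuous_askeyWeight hq0 hq1).aestronglyMeasurable)
    (integrable_weightMajorant_norm hq0 hq1 hp)
    (fun n => .of_forall (norm_askeyWeight_le hq0 hq1 (norm_pow_mul_le hq0 hq1 _ _)
      le_rfl le_rfl le_rfl)) (.of_forall fun t => ?_)
  have h := ((continuous_askeyH_param hq0 hq1 t).tendsto 0).comp (tendsto_pow_mul hq0 hq1 p₁)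
  exact (((h.mul_const _).mul_const _).mul_const _).div_const _

lemma qPoch_mul_integral_askeyWeight (hq0 : 0 < q) (hq1 : q < 1)
    (hp : ‖p₁ * p₂ * p₃ * p₄‖ < q ^ 3) (n : ℕ) :
    qPoch q (p₁ * p₂ * p₃ * p₄ / q ^ 3) n * ∫ t, askeyWeight q p₁ p₂ p₃ p₄ t =
      qPoch q (p₁ * p₂ / q) n * qPoch q (p₁ * p₃ / q) n * qPoch q (p₁ * p₄ / q) n *
        ∫ t, askeyWeight q ((q : ℂ) ^ n * p₁) p₂ p₃ p₄ t := by
  induction n with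
  | zero => simp [qPoch]
  | succ n ih =>
    have h := integral_askeyWeight_contiguous hq0 hq1 (norm_pow_mul_prod_lt hq0 hq1 hp n)
    simp only [qPoch, Finset.prod_range_succ] at ih ⊢
    rw [show (q : ℂ) ^ (n + 1) * p₁ = q * (q ^ n * p₁) by ring]
    calc _ = (1 - p₁ * p₂ * p₃ * p₄ / q ^ 3 * q ^ n) *
          ((∏ k ∈ Finset.range n, (1 - p₁ * p₂ * p₃ * p₄ / q ^ 3 * (q : ℂ) ^ k)) *
            ∫ t, askeyWeight q p₁ p₂ p₃ p₄ t) := by ring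
      _ = (∏ k ∈ Finset.range n, (1 - p₁ * p₂ / q * (q : ℂ) ^ k)) *
          (∏ k ∈ Finset.range n, (1 - p₁ * p₃ / q * (q : ℂ) ^ k)) *
          (∏ k ∈ Finset.range n, (1 - p₁ * p₄ / q * (q : ℂ) ^ k)) *
          ((1 - q ^ n * p₁ * p₂ * p₃ * p₄ / q ^ 3) *
            ∫ t, askeyWeight q ((q : ℂ) ^ n * p₁) p₂ p₃ p₄ t) := by rw [ih]; ring
      _ = _ := by rw [h]; ring

lemma qPochInf_mul_integral_askeyWeight (hq0 : 0 < q) (hq1 : q < 1)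
    (hp : ‖p₁ * p₂ * p₃ * p₄‖ < q ^ 3) :
    qPochInf q (p₁ * p₂ * p₃ * p₄ / q ^ 3) * ∫ t, askeyWeight q p₁ p₂ p₃ p₄ t =
      qPochInf q (p₁ * p₂ / q) * qPochInf q (p₁ * p₃ / q) * qPochInf q (p₁ * p₄ / q) *
        ∫ t, askeyWeight q 0 p₂ p₃ p₄ t := by
  have h1 := (tendsto_qPoch hq0 hq1 (p₁ * p₂ * p₃ * p₄ / q ^ 3)).mul_const
    (∫ t, askeyWeight q p₁ p₂ p₃ p₄ t)
  have h2 := (((tendsto_qPoch hq0 hq1 (p₁ * p₂ / q)).mul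
    (tendsto_qPoch hq0 hq1 (p₁ * p₃ / q))).mul (tendsto_qPoch hq0 hq1 (p₁ * p₄ / q))).mul
    (tendsto_integral_askeyWeight hq0 hq1 hp)
  simp only [qPoch_mul_integral_askeyWeight hq0 hq1 hp] at h1
  exact tendsto_nhds_unique h1 h2

lemma askeyWeight_rotate (p₁ p₂ p₃ p₄ : ℂ) :
    askeyWeight q p₁ p₂ p₃ p₄ = askeyWeight q p₂ p₃ p₄ p₁ := by
  funext t
  simp only [askeyWeight]
  ring

/-- Each parameter sent to 0 leaves behind its products with the remaining ones; products involving
an already vanished parameter contribute (0;q)_∞ = 1. -/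
lemma qPochInf_mul_integral_askeyWeight_eq_zero_params (hq0 : 0 < q) (hq1 : q < 1)
    (hp : ‖p₁ * p₂ * p₃ * p₄‖ < q ^ 3) :
    qPochInf q (p₁ * p₂ * p₃ * p₄ / q ^ 3) * ∫ t, askeyWeight q p₁ p₂ p₃ p₄ t =
      qPochInf q (p₁ * p₂ / q) * qPochInf q (p₁ * p₃ / q) * qPochInf q (p₁ * p₄ / q) *
        qPochInf q (p₂ * p₃ / q) * qPochInf q (p₂ * p₄ / q) * qPochInf q (p₃ * p₄ / q) *
        ∫ t, askeyWeight q 0 0 0 0 t := by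
  have hz : (0 : ℝ) < q ^ 3 := by positivity
  have h2 := qPochInf_mul_integral_askeyWeight (p₁ := p₂) (p₂ := p₃) (p₃ := p₄) (p₄ := 0) hq0 hq1
    (by simpa using hz)
  have h3 := qPochInf_mul_integral_askeyWeight (p₁ := p₃) (p₂ := p₄) (p₃ := 0) (p₄ := 0) hq0 hq1
    (by simpa using hz)
  have h4 := qPochInf_mul_integral_askeyWeight (p₁ := p₄) (p₂ := 0) (p₃ := 0) (p₄ := 0) hq0 hq1
    (by simpa using hz)
  simp only [mul_zero, zero_div, qPochInf_zero, one_mul, mul_one] at h2 h3 h4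
  rw [qPochInf_mul_integral_askeyWeight hq0 hq1 hp, askeyWeight_rotate 0 p₂ p₃ p₄, h2,
    askeyWeight_rotate 0 p₃ p₄ 0, h3, askeyWeight_rotate 0 p₄ 0 0, h4]
  ring

/-- The pair ±w yields the factors of (w²;q)_∞ with even exponent, the pair ±sw those with odd
exponent. -/
lemma qPochInf_mul_quadruple (hq0 : 0 < q) (hq1 : q < 1) {s : ℂ} (hs : s ^ 2 = q) (w : ℂ) :
    qPochInf q w * qPochInf q (-w) * (qPochInf q (s * w) * qPochInf q (-(s * w))) =
      qPochInf q (w ^ 2) := by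
  have hm := multipliable_qPochInf hq0 hq1
  have hsq := multipliable_qPochInf (q := q ^ 2) (by positivity)
    (pow_lt_one₀ hq0.le hq1 two_ne_zero)
  have he : Multipliable fun k : ℕ => 1 - w ^ 2 * (q : ℂ) ^ (2 * k) := by
    refine (hsq (w ^ 2)).congr fun k => ?_
    rw [pow_mul]; push_cast; rfl
  have ho : Multipliable fun k : ℕ => 1 - w ^ 2 * (q : ℂ) ^ (2 * k + 1) := by
    refine (hsq (w ^ 2 * q)).congr fun k => ?_
    rw [pow_succ (q : ℂ), pow_mul]; push_cast; ring
  have h1 : qPochInf q w * qPochInf q (-w) = ∏' k : ℕ, (1 - w ^ 2 * (q : ℂ) ^ (2 * k)) := by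
    refine ((hm w).tprod_mul (hm (-w))).symm.trans (tprod_congr fun k => ?_)
    rw [pow_mul']; ring
  have h2 : qPochInf q (s * w) * qPochInf q (-(s * w)) =
      ∏' k : ℕ, (1 - w ^ 2 * (q : ℂ) ^ (2 * k + 1)) := by
    refine ((hm (s * w)).tprod_mul (hm (-(s * w)))).symm.trans (tprod_congr fun k => ?_)
    rw [pow_succ (q : ℂ), pow_mul']
    linear_combination (-w ^ 2 * ((q : ℂ) ^ k) ^ 2) * hs
  rw [h1, h2]
  exact tprod_even_mul_odd (f := fun k : ℕ => 1 - w ^ 2 * (q : ℂ) ^ k) he ho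

/-- With u = e^{2t} the integrand becomes du/(2(1 + qu)(u + q)), and partial fractions give the
logarithm. -/
lemma hasDerivAt_log_quotient (hq0 : 0 < q) (hq1 : q < 1) (t : ℝ) :
    HasDerivAt (fun t : ℝ => Real.log ((Real.exp (2 * t) + q) / (1 + q * Real.exp (2 * t))) /
      (2 * (1 - q ^ 2))) ((1 + q * Real.exp t ^ 2) * (1 + q * Real.exp (-t) ^ 2))⁻¹ t := by
  have hz := Real.exp_pos t
  have he : HasDerivAt (fun t : ℝ => Real.exp (2 * t)) (Real.exp (2 * t) * 2) t := by
    simpa using ((hasDerivAt_id t).const_mul 2).exp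
  have h1 : HasDerivAt (fun t : ℝ => (Real.exp (2 * t) + q) / (1 + q * Real.exp (2 * t))) _ t :=
    (he.add_const q).fun_div ((he.const_mul q).const_add 1) (by positivity)
  refine ((h1.log (by positivity)).div_const _).congr_deriv ?_
  have e1 : Real.exp (2 * t) = Real.exp t ^ 2 := by rw [← Real.exp_nat_mul]; norm_num
  have hq2 : 1 - q ^ 2 ≠ 0 := by nlinarith
  rw [e1, Real.exp_neg]
  field_simp
  ring

lemma integral_inv_one_add_mul_exp (hq0 : 0 < q) (hq1 : q < 1)
    (hint : Integrable fun t : ℝ => ((1 + q * Real.exp t ^ 2) * (1 + q * Real.exp (-t) ^ 2))⁻¹) :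
    ∫ t : ℝ, ((1 + q * Real.exp t ^ 2) * (1 + q * Real.exp (-t) ^ 2))⁻¹ =
      Real.log q⁻¹ / (1 - q ^ 2) := by
  have hq2 : 1 - q ^ 2 ≠ 0 := by nlinarith
  have htop : Tendsto (fun t : ℝ => Real.log ((Real.exp (2 * t) + q) / (1 + q * Real.exp (2 * t))) /
      (2 * (1 - q ^ 2))) atTop (𝓝 (Real.log ((1 + q * 0) / (0 + q)) / (2 * (1 - q ^ 2)))) := by
    have h0 : Tendsto (fun t : ℝ => Real.exp (-(2 * t))) atTop (𝓝 0) :=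
      Real.tendsto_exp_neg_atTop_nhds_zero.comp (tendsto_id.const_mul_atTop two_pos)
    have h1 := ((h0.const_mul q).const_add 1).div (h0.add_const q) (by simpa using hq0.ne')
    refine ((h1.log (by simpa using hq0.ne')).div_const _).congr fun t => ?_
    congr 2
    simp only [Pi.div_apply]
    rw [Real.exp_neg]
    have := Real.exp_pos (2 * t)
    field_simp
  have hbot : Tendsto (fun t : ℝ => Real.log ((Real.exp (2 * t) + q) / (1 + q * Real.exp (2 * t))) /
      (2 * (1 - q ^ 2))) atBot (𝓝 (Real.log ((0 + q) / (1 + q * 0)) / (2 * (1 - q ^ 2)))) := by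
    have h0 : Tendsto (fun t : ℝ => Real.exp (2 * t)) atBot (𝓝 0) :=
      Real.tendsto_exp_atBot.comp (tendsto_id.const_mul_atBot two_pos)
    have h1 := (h0.add_const q).div ((h0.const_mul q).const_add 1) (by simp)
    exact (h1.log (by simpa using hq0.ne')).div_const _
  rw [integral_of_hasDerivAt_of_tendsto (hasDerivAt_log_quotient hq0 hq1) hint hbot htop]
  simp only [mul_zero, add_zero, zero_add, div_one, one_div, Real.log_inv]
  field_simp
  ring

/-- The four parameters collapse the numerator to (-q²e^{2t}, -q²e^{-2t};q)_∞, which is the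
denominator without its two leading factors. -/
lemma askeyWeight_special (hq0 : 0 < q) (hq1 : q < 1) {s : ℂ} (hs : s ^ 2 = q) (t : ℝ) :
    askeyWeight q q (-q) (s * q) (-(s * q)) t =
      ((((1 + q * Real.exp t ^ 2) * (1 + q * Real.exp (-t) ^ 2))⁻¹ : ℝ) : ℂ) := by
  have h1 := qPochInf_mul_quadruple hq0 hq1 hs (Complex.I * q * Real.exp t)
  have h2 := qPochInf_mul_quadruple hq0 hq1 hs (Complex.I * q * Real.exp (-t))
  have hd : ∀ z : ℝ, qPochInf q (-((q * z ^ 2 : ℝ) : ℂ)) =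
      ((1 + q * z ^ 2 : ℝ) : ℂ) * qPochInf q ((Complex.I * q * z) ^ 2) := by
    intro z
    rw [qPochInf_eq_one_sub_mul hq0 hq1, mul_pow, mul_pow, Complex.I_sq]
    push_cast
    ring_nf
  have hne := askeyH_cosh_ne_zero hq0 hq1 t
  rw [askeyWeight]
  rw [askeyH_cosh_two_mul hq0 hq1, hd, hd] at hne ⊢
  have n1 := right_ne_zero_of_mul (left_ne_zero_of_mul hne)
  have n2 := right_ne_zero_of_mul (right_ne_zero_of_mul hne)
  simp only [askeyH_I_mul_sinh hq0 hq1]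
  rw [Complex.ofReal_inv, Complex.ofReal_mul, div_eq_iff hne, inv_mul_eq_div, eq_div_iff (by
    exact mul_ne_zero (left_ne_zero_of_mul (left_ne_zero_of_mul hne))
      (left_ne_zero_of_mul (right_ne_zero_of_mul hne)))]
  rw [← h1, ← h2]
  ring_nf

lemma integral_askeyWeight_zero (hq0 : 0 < q) (hq1 : q < 1) :
    ∫ t, askeyWeight q 0 0 0 0 t = qPochInf q q * Real.log q⁻¹ := by
  obtain ⟨s, hs⟩ : ∃ s : ℂ, s ^ 2 = q := ⟨((q : ℂ)) ^ ((2 : ℂ)⁻¹), by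
    rw [← Complex.cpow_nat_mul]; norm_num⟩
  have hq : (q : ℂ) ≠ 0 := by exact_mod_cast hq0.ne'
  have hnq : ‖(q : ℂ)‖ < 1 := by rwa [Complex.norm_real, Real.norm_of_nonneg hq0.le]
  have hprod : (q : ℂ) * -q * (s * q) * -(s * q) = q ^ 5 := by
    linear_combination (q : ℂ) ^ 4 * hs
  have hp : ‖(q : ℂ) * -q * (s * q) * -(s * q)‖ < q ^ 3 := by
    rw [hprod, norm_pow, Complex.norm_real, Real.norm_of_nonneg hq0.le]
    exact pow_lt_pow_right_of_lt_one₀ hq0 hq1 (by norm_num)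
  have hint := integrable_askeyWeight hq0 hq1 hp
  have hrel := qPochInf_mul_integral_askeyWeight_eq_zero_params hq0 hq1 hp
  rw [funext (askeyWeight_special hq0 hq1 hs)] at hint
  simp only [askeyWeight_special hq0 hq1 hs] at hrel
  have hval : ∫ t : ℝ, ((((1 + q * Real.exp t ^ 2) * (1 + q * Real.exp (-t) ^ 2))⁻¹ : ℝ) : ℂ) =
      ((Real.log q⁻¹ / (1 - q ^ 2) : ℝ) : ℂ) := by
    rw [← integral_inv_one_add_mul_exp hq0 hq1 hint.re]
    exact integral_ofReal
  rw [hval, hprod,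
    show (q : ℂ) ^ 5 / q ^ 3 = q * q by field_simp,
    show (q : ℂ) * -q / q = -q by field_simp,
    show (q : ℂ) * (s * q) / q = s * q by field_simp,
    show (q : ℂ) * -(s * q) / q = -(s * q) by field_simp,
    show -(q : ℂ) * (s * q) / q = -(s * q) by field_simp,
    show -(q : ℂ) * -(s * q) / q = s * q by field_simp,
    show s * (q : ℂ) * -(s * q) / q = -q * q by field_simp; rw [hs]] at hrel
  have hE := qPochInf_mul_quadruple hq0 hq1 hs s
  rw [← pow_two s, hs, qPochInf_eq_one_sub_mul hq0 hq1 s,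
    qPochInf_eq_one_sub_mul hq0 hq1 (-s)] at hE
  have hm := qPochInf_eq_one_sub_mul hq0 hq1 (-(q : ℂ))
  have hp := qPochInf_eq_one_sub_mul hq0 hq1 (q : ℂ)
  have hn := qPochInf_ne_zero_of_norm_lt_one hq0 hq1 hnq
  have hn1 : (1 - (q : ℂ)) ≠ 0 := by
    exact_mod_cast (sub_pos.2 hq1).ne'
  have hn2 : (1 + (q : ℂ)) ≠ 0 := by
    exact_mod_cast (by positivity : (1 + q) ≠ 0)
  rw [neg_mul] at hE
  generalize qPochInf q (s * q) = B at *
  generalize qPochInf q (-(s * q)) = C at *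
  generalize qPochInf q (q : ℂ) = P at *
  generalize qPochInf q (-(q : ℂ)) = M at *
  generalize qPochInf q (-(q : ℂ) * q) = M2 at *
  generalize qPochInf q ((q : ℂ) * q) = P2 at *
  generalize ∫ t, askeyWeight q 0 0 0 0 t = J at *
  -- This is the quadruple identity at w = s, where (q;q)_∞ occurs on both sides and cancels.
  have hu : (1 - q) * B * C * M = 1 := by
    refine mul_right_cancel₀ hn ?_
    linear_combination hE + B * C * P * M * hs
  push_cast at hrel
  have hn3 : (1 - (q : ℂ) ^ 2) ≠ 0 := by
    rw [show (1 - (q : ℂ) ^ 2) = (1 - q) * (1 + q) by ring]; exact mul_ne_zero hn1 hn2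
  have h3 : P * (Real.log q⁻¹ : ℂ) = (1 - q) ^ 2 * (1 + q) * (M * B * C * C * B * M2) * J := by
    have : P2 * (Real.log q⁻¹ : ℂ) = (1 - q ^ 2) * (M * B * C * C * B * M2 * J) := by
      rw [← hrel]
      field_simp
    rw [hp]
    linear_combination (1 - (q : ℂ)) * this
  have hMM : (1 + q) * M2 = M := by rw [hm]; ring
  have h4 : (1 - (q : ℂ)) ^ 2 * (1 + q) * (M * B * C * C * B * M2) = 1 := by
    calc _ = ((1 - (q : ℂ)) * B * C * M) * ((1 - q) * B * C * ((1 + q) * M2)) := by ring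
      _ = 1 := by rw [hMM, hu, one_mul]
  rw [h3, h4, one_mul]

/-- **Askey's integral.** -/
theorem integral_askeyWeight (hq0 : 0 < q) (hq1 : q < 1) (hp : ‖p₁ * p₂ * p₃ * p₄‖ < q ^ 3) :
    qPochInf q (p₁ * p₂ * p₃ * p₄ / q ^ 3) * ∫ t, askeyWeight q p₁ p₂ p₃ p₄ t =
      qPochInf q (p₁ * p₂ / q) * qPochInf q (p₁ * p₃ / q) * qPochInf q (p₁ * p₄ / q) *
        qPochInf q (p₂ * p₃ / q) * qPochInf q (p₂ * p₄ / q) * qPochInf q (p₃ * p₄ / q) *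
        (qPochInf q q * Real.log q⁻¹) := by
  rw [qPochInf_mul_integral_askeyWeight_eq_zero_params hq0 hq1 hp,
    integral_askeyWeight_zero hq0 hq1]

end AskeyIntegral

/-! ### Terminating q-binomial theorem and decay of q-differences. -/

section QBinomial

variable {q : ℝ}

lemma qPoch_succ (a : ℂ) (n : ℕ) : qPoch q a (n + 1) = qPoch q a n * (1 - a * (q : ℂ) ^ n) :=
  Finset.prod_range_succ _ _

lemma qPoch_succ_left (a : ℂ) (n : ℕ) : qPoch q a (n + 1) = (1 - a) * qPoch q (a * q) n := by
  rw [qPoch, Finset.prod_range_succ', qPoch, mul_comm, pow_zero, mul_one]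
  congr 1
  exact Finset.prod_congr rfl fun k _ => by rw [pow_succ']; ring

lemma qPoch_ne_zero {a : ℂ} (ha : ∀ k : ℕ, a * (q : ℂ) ^ k ≠ 1) (n : ℕ) : qPoch q a n ≠ 0 :=
  Finset.prod_ne_zero_iff.2 fun k _ => sub_ne_zero.2 (ha k).symm

lemma qPoch_inv_pow_eq_zero (hq0 : 0 < q) {k n : ℕ} (h : k < n) :
    qPoch q ((q : ℂ) ^ k)⁻¹ n = 0 := by
  have hq : (q : ℂ) ≠ 0 := by exact_mod_cast hq0.ne'
  exact Finset.prod_eq_zero (Finset.mem_range.2 h) (by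
    rw [inv_mul_cancel₀ (pow_ne_zero _ hq), sub_self])

/-- The coefficients `(q^{-k};q)_j / (q;q)_j` of the terminating `q`-binomial theorem. -/
noncomputable def qBinomialCoeff (q : ℝ) (k j : ℕ) : ℂ :=
  qPoch q ((q : ℂ) ^ k)⁻¹ j / qPoch q q j

lemma norm_ofReal_lt_one (hq0 : 0 < q) (hq1 : q < 1) : ‖(q : ℂ)‖ < 1 := by
  rwa [Complex.norm_real, Real.norm_of_nonneg hq0.le]

/-- The q-Pascal rule that drives the induction for the q-binomial theorem. -/
lemma qBinomialCoeff_succ_succ (hq0 : 0 < q) (hq1 : q < 1) (k j : ℕ) :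
    qBinomialCoeff q (k + 1) (j + 1) =
      qBinomialCoeff q k (j + 1) - ((q : ℂ) ^ (k + 1))⁻¹ * qBinomialCoeff q k j := by
  have hq : (q : ℂ) ≠ 0 := by exact_mod_cast hq0.ne'
  have hqq := mul_pow_ne_one_of_norm_lt_one hq0 hq1 (norm_ofReal_lt_one hq0 hq1)
  have hn := qPoch_ne_zero hqq j
  have hn1 : 1 - (q : ℂ) * q ^ j ≠ 0 := sub_ne_zero.2 (hqq j).symm
  have e : ((q : ℂ) ^ (k + 1))⁻¹ * q = ((q : ℂ) ^ k)⁻¹ := by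
    rw [pow_succ]; field_simp
  rw [qBinomialCoeff, qBinomialCoeff, qBinomialCoeff, qPoch_succ_left, e,
    qPoch_succ ((q : ℂ) ^ k)⁻¹, qPoch_succ (q : ℂ)]
  field_simp
  ring

/-- The terminating `q`-binomial theorem. -/
lemma sum_qBinomialCoeff_mul_pow (hq0 : 0 < q) (hq1 : q < 1) (k : ℕ) (z : ℂ) :
    ∑ j ∈ Finset.range (k + 1), qBinomialCoeff q k j * z ^ j =
      ∏ i ∈ Finset.range k, (1 - z * ((q : ℂ) ^ (i + 1))⁻¹) := by
  induction k with
  | zero => simp [qBinomialCoeff, qPoch]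
  | succ k ih =>
    have hlast : qBinomialCoeff q k (k + 1) = 0 := by
      rw [qBinomialCoeff, qPoch_inv_pow_eq_zero hq0 (Nat.lt_succ_self k), zero_div]
    have h0 : ∀ k, qBinomialCoeff q k 0 = 1 := fun k => by simp [qBinomialCoeff, qPoch]
    have h1 : ∑ j ∈ Finset.range (k + 1), qBinomialCoeff q k (j + 1) * z ^ (j + 1) + 1 =
        ∑ j ∈ Finset.range (k + 1), qBinomialCoeff q k j * z ^ j := by
      have := Finset.sum_range_succ' (fun j => qBinomialCoeff q k j * z ^ j) (k + 1)
      rw [Finset.sum_range_succ, hlast, zero_mul, add_zero] at this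
      rw [this, h0, pow_zero, mul_one]
    rw [Finset.sum_range_succ', h0, Finset.prod_range_succ, ← ih]
    calc _ = (∑ j ∈ Finset.range (k + 1), qBinomialCoeff q k (j + 1) * z ^ (j + 1) + 1) -
          z * ((q : ℂ) ^ (k + 1))⁻¹ *
            ∑ j ∈ Finset.range (k + 1), qBinomialCoeff q k j * z ^ j := by
          simp only [qBinomialCoeff_succ_succ hq0 hq1, sub_mul, Finset.sum_sub_distrib,
            Finset.mul_sum, pow_zero, mul_one]
          have : ∀ j, ((q : ℂ) ^ (k + 1))⁻¹ * qBinomialCoeff q k j * z ^ (j + 1) =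
              z * ((q : ℂ) ^ (k + 1))⁻¹ * (qBinomialCoeff q k j * z ^ j) := fun j => by ring
          simp only [this]
          ring
      _ = _ := by rw [h1]; ring

/-- The product is the q-difference of the monomial z^m; the extra weight q^j shifts the exponent to
m + 1. Degrees below k are annihilated by the factor i = m. -/
lemma prod_one_sub_pow_mul_inv_eq_zero (hq0 : 0 < q) {k m : ℕ} (h : m < k) :
    ∏ i ∈ Finset.range k, (1 - (q : ℂ) ^ (m + 1) * ((q : ℂ) ^ (i + 1))⁻¹) = 0 := by
  have hq : (q : ℂ) ≠ 0 := by exact_mod_cast hq0.ne'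
  exact Finset.prod_eq_zero (Finset.mem_range.2 h) (by
    rw [mul_inv_cancel₀ (pow_ne_zero _ hq), sub_self])

lemma norm_prod_one_sub_pow_mul_inv_le (hq0 : 0 < q) (hq1 : q < 1) {k m : ℕ} (h : k ≤ m) :
    ‖∏ i ∈ Finset.range k, (1 - (q : ℂ) ^ (m + 1) * ((q : ℂ) ^ (i + 1))⁻¹)‖ ≤ 1 := by
  have hq : (q : ℂ) ≠ 0 := by exact_mod_cast hq0.ne'
  rw [norm_prod]
  refine Finset.prod_le_one (fun _ _ => norm_nonneg _) fun i hi => ?_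
  have hi' : i + 1 ≤ m + 1 := by have := Finset.mem_range.1 hi; omega
  rw [← pow_sub₀ _ hq hi', show (1 : ℂ) - (q : ℂ) ^ (m + 1 - (i + 1)) =
    ((1 - q ^ (m + 1 - (i + 1)) : ℝ) : ℂ) by push_cast; rfl, Complex.norm_real]
  have h1 : q ^ (m + 1 - (i + 1)) ≤ 1 := pow_le_one₀ hq0.le hq1.le
  have h2 : 0 < q ^ (m + 1 - (i + 1)) := by positivity
  rw [Real.norm_of_nonneg (by linarith)]
  linarith

/-- The `k`-th `q`-difference at the points `q^j` of a function analytic on a disc of radius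
`R > 1` is `O(R^{-k})`. -/
lemma norm_sum_qBinomialCoeff_mul_le (hq0 : 0 < q) (hq1 : q < 1) {f : ℂ → ℂ} {R M : ℝ}
    (hR : 1 < R) (hf : DifferentiableOn ℂ f (Metric.closedBall 0 R))
    (hM : ∀ z ∈ Metric.closedBall (0 : ℂ) R, ‖f z‖ ≤ M) (k : ℕ) :
    ‖∑ j ∈ Finset.range (k + 1), qBinomialCoeff q k j * (q : ℂ) ^ j * f ((q : ℂ) ^ j)‖ ≤
      M * (R⁻¹) ^ k * (1 - R⁻¹)⁻¹ := by
  have hR0 : 0 < R := one_pos.trans hR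
  have hM0 : 0 ≤ M := (norm_nonneg _).trans (hM 0 (by simp [hR0.le]))
  set a : ℕ → ℂ := fun m => (m.factorial : ℂ)⁻¹ * iteratedDeriv m f 0 with ha
  -- Cauchy's estimate on the circle of radius R.
  have hcoef : ∀ m, ‖a m‖ ≤ M * (R⁻¹) ^ m := by
    intro m
    have h := Complex.norm_iteratedDeriv_le_of_forall_mem_sphere_norm_le m hR0
      (hf.mono Metric.closure_ball_subset_closedBall).diffContOnCl
      (fun z hz => hM z (Metric.sphere_subset_closedBall hz))
    have hfac : (0 : ℝ) < m.factorial := by exact_mod_cast m.factorial_pos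
    rw [ha]
    simp only [norm_mul, norm_inv, Complex.norm_natCast]
    rw [inv_mul_le_iff₀ hfac, inv_pow]
    calc _ ≤ _ := h
      _ = _ := by field_simp
  have hsum : ∀ j : ℕ, HasSum (fun m => a m * ((q : ℂ) ^ j) ^ m) (f ((q : ℂ) ^ j)) := by
    intro j
    have hmem : (q : ℂ) ^ j ∈ Metric.ball (0 : ℂ) R := by
      rw [mem_ball_zero_iff, norm_pow, Complex.norm_real, Real.norm_of_nonneg hq0.le]
      exact (pow_le_one₀ hq0.le hq1.le).trans_lt hR
    have := Complex.hasSum_taylorSeries_on_ball (hf.mono Metric.ball_subset_closedBall) hmem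
    refine this.congr_fun ?_
    intro m
    simp only [ha, smul_eq_mul, sub_zero]
    ring
  have htot : HasSum (fun m => a m *
      ∏ i ∈ Finset.range k, (1 - (q : ℂ) ^ (m + 1) * ((q : ℂ) ^ (i + 1))⁻¹))
      (∑ j ∈ Finset.range (k + 1), qBinomialCoeff q k j * (q : ℂ) ^ j * f ((q : ℂ) ^ j)) := by
    refine (hasSum_sum fun j _ => (hsum j).mul_left (qBinomialCoeff q k j * (q : ℂ) ^ j)).congr_fun
      fun m => ?_
    rw [← sum_qBinomialCoeff_mul_pow hq0 hq1, Finset.mul_sum]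
    refine Finset.sum_congr rfl fun j _ => ?_
    rw [← pow_mul, ← pow_mul]
    ring
  -- The first k Taylor coefficients drop out, so the sum starts at order R^{-k}.
  have hshift := (hasSum_nat_add_iff' k).2 htot
  have hhead : ∑ m ∈ Finset.range k, a m *
      ∏ i ∈ Finset.range k, (1 - (q : ℂ) ^ (m + 1) * ((q : ℂ) ^ (i + 1))⁻¹) = 0 :=
    Finset.sum_eq_zero fun m hm => by
      rw [prod_one_sub_pow_mul_inv_eq_zero hq0 (Finset.mem_range.1 hm), mul_zero]
  rw [hhead, sub_zero] at hshift
  have hgeo := (hasSum_geometric_of_lt_one (inv_nonneg.2 hR0.le) (inv_lt_one_of_one_lt₀ hR)).mul_left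
    (M * (R⁻¹) ^ k)
  rw [← hshift.tsum_eq]
  refine tsum_of_norm_bounded hgeo fun m => ?_
  rw [norm_mul]
  calc _ ≤ (M * (R⁻¹) ^ (m + k)) * 1 := by
        gcongr
        · exact hcoef _
        · exact norm_prod_one_sub_pow_mul_inv_le hq0 hq1 (Nat.le_add_left k m)
    _ = _ := by ring

end QBinomial

/-! ### The ₄φ₃ against the weight: bounds and termwise integrals. -/

section Reversal

variable {q a : ℝ} {b c d : ℂ}

/-- The part of the analytic interpolation in `q^j` of the `j`-th term of the `₄φ₃` series that
does not depend on `t`. -/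
noncomputable def interpolant (q a : ℝ) (b c d z : ℂ) : ℂ :=
  qPochInf q (q * a * b) * qPochInf q (q * a * c) * qPochInf q (q * a * d) /
      qPochInf q (q * a * b * c * d) *
    (qPochInf q (q * a * b * c * d * z) /
      (qPochInf q (q * a * b * z) * qPochInf q (q * a * c * z) * qPochInf q (q * a * d * z)))

lemma qPochInf_mul_ne_zero_of_mem_closedBall (hq0 : 0 < q) (hq1 : q < 1) {w z : ℂ} {R : ℝ}
    (hw : ‖w‖ * R < 1) (hz : z ∈ Metric.closedBall (0 : ℂ) R) : qPochInf q (w * z) ≠ 0 := by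
  refine qPochInf_ne_zero_of_norm_lt_one hq0 hq1 ?_
  rw [mem_closedBall_zero_iff] at hz
  rw [norm_mul]
  exact (mul_le_mul_of_nonneg_left hz (norm_nonneg _)).trans_lt hw

lemma differentiableOn_interpolant (hq0 : 0 < q) (hq1 : q < 1) {R : ℝ}
    (hb : ‖(q * a * b : ℂ)‖ * R < 1) (hc : ‖(q * a * c : ℂ)‖ * R < 1)
    (hd : ‖(q * a * d : ℂ)‖ * R < 1) :
    DifferentiableOn ℂ (interpolant q a b c d) (Metric.closedBall 0 R) := by
  have h := differentiable_qPochInf hq0 hq1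
  have hw : ∀ w : ℂ, Differentiable ℂ fun z => qPochInf q (w * z) := fun w =>
    h.comp (differentiable_id.const_mul w)
  unfold interpolant
  refine DifferentiableOn.const_mul (DifferentiableOn.div (hw _).differentiableOn
    (((hw _).mul (hw _)).mul (hw _)).differentiableOn fun z hz => ?_) _
  exact mul_ne_zero (mul_ne_zero (qPochInf_mul_ne_zero_of_mem_closedBall hq0 hq1 hb hz)
    (qPochInf_mul_ne_zero_of_mem_closedBall hq0 hq1 hc hz))
    (qPochInf_mul_ne_zero_of_mem_closedBall hq0 hq1 hd hz)

lemma askeyH_sinh_real_ne_zero (hq0 : 0 < q) (hq1 : q < 1) (a t : ℝ) :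
    askeyH q (Complex.I * Real.sinh t) (q * a) ≠ 0 := by
  rw [askeyH_I_mul_sinh hq0 hq1,
    show Complex.I * (q * a) * (Real.exp t : ℂ) = Complex.I * ((q * a * Real.exp t : ℝ) : ℂ) by
      push_cast; ring,
    show -Complex.I * (q * a) * (Real.exp (-t) : ℂ) =
      Complex.I * ((-(q * a * Real.exp (-t)) : ℝ) : ℂ) by push_cast; ring]
  exact mul_ne_zero (qPochInf_I_mul_ofReal_ne_zero hq0 hq1 _)
    (qPochInf_I_mul_ofReal_ne_zero hq0 hq1 _)

lemma qPoch_eq_div (hq0 : 0 < q) (hq1 : q < 1) {w : ℂ} {n : ℕ}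
    (h : qPochInf q (w * (q : ℂ) ^ n) ≠ 0) :
    qPoch q w n = qPochInf q w / qPochInf q (w * (q : ℂ) ^ n) := by
  rw [eq_div_iff h, ← qPochInf_eq_qPoch_mul hq0 hq1]

lemma qPochInf_mul_pow_ne_zero (hq0 : 0 < q) (hq1 : q < 1) {w : ℂ} (hw : ‖w‖ < 1) (j : ℕ) :
    qPochInf q (w * (q : ℂ) ^ j) ≠ 0 := by
  refine qPochInf_ne_zero_of_norm_lt_one hq0 hq1 ?_
  rw [mul_comm]
  exact (norm_pow_mul_le hq0 hq1 w j).trans_lt hw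

/-- The terminating `₄φ₃` series of the reversal formula. -/
noncomputable def reversalSeries (q a : ℝ) (b c d : ℂ) (t : ℝ) (k : ℕ) : ℂ :=
  basicHypergeometric q
      [((q : ℂ) ^ k)⁻¹, q * a * b, q * a * c, q * a * d]
      [Complex.I * a * q * Real.exp t, -Complex.I * a * q * Real.exp (-t), q * a * b * c * d]
      q

/-- Writing (w;q)_j = (w;q)_∞/(wq^j;q)_∞ exhibits each term as the value at z = q^j of a function
analytic in z; the terms j > k vanish through (q^{-k};q)_j. -/
lemma reversalSeries_eq_sum (hq0 : 0 < q) (hq1 : q < 1) (hb : ‖(q * a * b : ℂ)‖ < 1)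
    (hc : ‖(q * a * c : ℂ)‖ < 1) (hd : ‖(q * a * d : ℂ)‖ < 1)
    (hbcd : ‖(q * a * b * c * d : ℂ)‖ < 1) (t : ℝ) (k : ℕ) :
    reversalSeries q a b c d t k = ∑ j ∈ Finset.range (k + 1),
      qBinomialCoeff q k j * (q : ℂ) ^ j * (interpolant q a b c d ((q : ℂ) ^ j) *
        (askeyH q (Complex.I * Real.sinh t) (q * a * (q : ℂ) ^ j) /
          askeyH q (Complex.I * Real.sinh t) (q * a))) := by
  rw [reversalSeries, basicHypergeometric, tsum_eq_sum (s := Finset.range (k + 1))]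
  · refine Finset.sum_congr rfl fun j _ => ?_
    have e1 : Complex.I * a * q * (Real.exp t : ℂ) = Complex.I * ((a * q * Real.exp t : ℝ) : ℂ) := by
      push_cast; ring
    have e2 : -Complex.I * a * q * (Real.exp (-t) : ℂ) =
        Complex.I * ((-(a * q * Real.exp (-t)) : ℝ) : ℂ) := by push_cast; ring
    have n1 : qPochInf q (Complex.I * a * q * (Real.exp t : ℂ) * (q : ℂ) ^ j) ≠ 0 := by
      rw [e1, mul_assoc, ← Complex.ofReal_pow, ← Complex.ofReal_mul]
      exact qPochInf_I_mul_ofReal_ne_zero hq0 hq1 _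
    have n2 : qPochInf q (-Complex.I * a * q * (Real.exp (-t) : ℂ) * (q : ℂ) ^ j) ≠ 0 := by
      rw [e2, mul_assoc, ← Complex.ofReal_pow, ← Complex.ofReal_mul]
      exact qPochInf_I_mul_ofReal_ne_zero hq0 hq1 _
    have nb := qPochInf_mul_pow_ne_zero hq0 hq1 hb j
    have nc := qPochInf_mul_pow_ne_zero hq0 hq1 hc j
    have nd := qPochInf_mul_pow_ne_zero hq0 hq1 hd j
    have nbcd := qPochInf_mul_pow_ne_zero hq0 hq1 hbcd j
    have hexp : (1 + (([Complex.I * a * q * (Real.exp t : ℂ),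
        -Complex.I * a * q * (Real.exp (-t) : ℂ), q * a * b * c * d] : List ℂ).length : ℤ) -
        (([((q : ℂ) ^ k)⁻¹, q * a * b, q * a * c, q * a * d] : List ℂ).length : ℤ)) = 0 := by
      simp
    rw [hexp, zpow_zero, mul_one]
    simp only [qPochList, List.map_cons, List.map_nil, List.prod_cons, List.prod_nil, mul_one]
    rw [qPoch_eq_div hq0 hq1 nb, qPoch_eq_div hq0 hq1 nc, qPoch_eq_div hq0 hq1 nd,
      qPoch_eq_div hq0 hq1 nbcd, qPoch_eq_div hq0 hq1 n1, qPoch_eq_div hq0 hq1 n2,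
      askeyH_I_mul_sinh hq0 hq1, askeyH_I_mul_sinh hq0 hq1, interpolant, qBinomialCoeff,
      show Complex.I * (q * a * (q : ℂ) ^ j) * (Real.exp t : ℂ) =
        Complex.I * a * q * (Real.exp t : ℂ) * (q : ℂ) ^ j by ring,
      show -Complex.I * (q * a * (q : ℂ) ^ j) * (Real.exp (-t) : ℂ) =
        -Complex.I * a * q * (Real.exp (-t) : ℂ) * (q : ℂ) ^ j by ring,
      show Complex.I * (q * a) * (Real.exp t : ℂ) = Complex.I * a * q * (Real.exp t : ℂ) by ring,
      show -Complex.I * (q * a) * (Real.exp (-t) : ℂ) =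
        -Complex.I * a * q * (Real.exp (-t) : ℂ) by ring]
    simp only [div_eq_mul_inv, mul_inv, inv_inv]
    ring
  · intro j hj
    rw [qPochList, List.map_cons, List.prod_cons,
      qPoch_inv_pow_eq_zero hq0 (by simpa using hj), zero_mul, zero_div, zero_mul, zero_mul]

/-- The interpolant is bounded on |z| ≤ R independently of t, and h(i sinh t;qaz) is bounded there
by its majorant at modulus qaR; the q-difference estimate does the rest. -/
lemma exists_norm_reversalSeries_le (hq0 : 0 < q) (hq1 : q < 1) (ha : 0 < a) {R : ℝ} (hR : 1 < R)
    (hb : ‖(q * a * b : ℂ)‖ * R < 1) (hc : ‖(q * a * c : ℂ)‖ * R < 1)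
    (hd : ‖(q * a * d : ℂ)‖ * R < 1) (hbcd : ‖(q * a * b * c * d : ℂ)‖ < 1) :
    ∃ C : ℝ, 0 ≤ C ∧ ∀ t k, ‖reversalSeries q a b c d t k‖ ≤
      C * (qPochMajorant q (q * a * R * Real.exp t) * qPochMajorant q (q * a * R * Real.exp (-t)) /
        ‖askeyH q (Complex.I * Real.sinh t) (q * a)‖) * (R⁻¹) ^ k := by
  have hlt : ∀ w : ℂ, ‖w‖ * R < 1 → ‖w‖ < 1 := fun w hw => by nlinarith [norm_nonneg w]
  have hdiff := differentiableOn_interpolant hq0 hq1 hb hc hd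
  obtain ⟨K, hK⟩ := (isCompact_closedBall (0 : ℂ) R).exists_bound_of_continuousOn hdiff.continuousOn
  have hR1 : 0 < 1 - R⁻¹ := sub_pos.2 (inv_lt_one_of_one_lt₀ hR)
  have hK0 : 0 ≤ K := (norm_nonneg _).trans (hK 0 (by simp; linarith))
  refine ⟨K * (1 - R⁻¹)⁻¹, by positivity, fun t k => ?_⟩
  have hH : Differentiable ℂ fun z : ℂ => askeyH q (Complex.I * Real.sinh t) (q * a * z) := by
    have := differentiable_qPochInf hq0 hq1
    simp only [askeyH_I_mul_sinh hq0 hq1]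
    fun_prop
  rw [reversalSeries_eq_sum hq0 hq1 (hlt _ hb) (hlt _ hc) (hlt _ hd) hbcd]
  refine (norm_sum_qBinomialCoeff_mul_le hq0 hq1
    (f := fun z => interpolant q a b c d z * (askeyH q (Complex.I * Real.sinh t) (q * a * z) /
      askeyH q (Complex.I * Real.sinh t) (q * a))) hR
    (hdiff.mul (hH.div_const _).differentiableOn)
    (M := K * (qPochMajorant q (q * a * R * Real.exp t) *
      qPochMajorant q (q * a * R * Real.exp (-t)) /
        ‖askeyH q (Complex.I * Real.sinh t) (q * a)‖)) (fun z hz => ?_) k).trans (le_of_eq ?_)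
  · rw [norm_mul, norm_div]
    refine mul_le_mul (hK z hz) (div_le_div_of_nonneg_right
      (norm_askeyH_sinh_le hq0 hq1 ?_ t) (norm_nonneg _)) (by positivity) hK0
    rw [mem_closedBall_zero_iff] at hz
    rw [norm_mul, norm_mul, Complex.norm_real, Complex.norm_real, Real.norm_of_nonneg hq0.le,
      Real.norm_of_nonneg ha.le]
    gcongr
  · ring

lemma reversalWeight_eq_askeyWeight :
    reversalWeight q a b c d = askeyWeight q (q * a) (q * b) (q * c) (q * d) := by
  funext t
  simp [reversalWeight, askeyHList, askeyWeight, mul_assoc]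

lemma reversalWeight_mul_reversalSeries (hq0 : 0 < q) (hq1 : q < 1) (hb : ‖(q * a * b : ℂ)‖ < 1)
    (hc : ‖(q * a * c : ℂ)‖ < 1) (hd : ‖(q * a * d : ℂ)‖ < 1)
    (hbcd : ‖(q * a * b * c * d : ℂ)‖ < 1) (t : ℝ) (k : ℕ) :
    reversalWeight q a b c d t * reversalSeries q a b c d t k = ∑ j ∈ Finset.range (k + 1),
      qBinomialCoeff q k j * (q : ℂ) ^ j * interpolant q a b c d ((q : ℂ) ^ j) *
        askeyWeight q (q * a * (q : ℂ) ^ j) (q * b) (q * c) (q * d) t := by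
  rw [reversalSeries_eq_sum hq0 hq1 hb hc hd hbcd, Finset.mul_sum, reversalWeight_eq_askeyWeight]
  refine Finset.sum_congr rfl fun j _ => ?_
  have h := askeyH_sinh_real_ne_zero hq0 hq1 a t
  simp only [askeyWeight]
  field_simp

/-- The factor h(i sinh t;qa) of the weight cancels the denominator of the series bound, so the
product is majorized as an Askey weight with first parameter s, later qaR. -/
lemma norm_reversalWeight_mul_le (hq0 : 0 < q) (hq1 : q < 1) (t s : ℝ) :
    ‖reversalWeight q a b c d t‖ * (qPochMajorant q (s * Real.exp t) *
      qPochMajorant q (s * Real.exp (-t)) / ‖askeyH q (Complex.I * Real.sinh t) (q * a)‖) ≤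
      weightMajorant q s ‖(q * b : ℂ)‖ ‖(q * c : ℂ)‖ ‖(q * d : ℂ)‖ t := by
  have h := norm_pos_iff.2 (askeyH_sinh_real_ne_zero hq0 hq1 a t)
  have hn : ∀ r, 0 ≤ qPochMajorant q r := fun r => norm_nonneg _
  have hn' : ∀ r s, 0 ≤ qPochMajorant q r * qPochMajorant q s := fun r s =>
    mul_nonneg (hn r) (hn s)
  rw [reversalWeight_eq_askeyWeight, weightMajorant_eq hq0 hq1, askeyWeight, norm_div, norm_mul,
    norm_mul, norm_mul]
  calc _ = qPochMajorant q (s * Real.exp t) * qPochMajorant q (s * Real.exp (-t)) *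
        ‖askeyH q (Complex.I * Real.sinh t) (q * b)‖ *
        ‖askeyH q (Complex.I * Real.sinh t) (q * c)‖ *
        ‖askeyH q (Complex.I * Real.sinh t) (q * d)‖ /
        ‖askeyH q (Real.cosh (2 * t) : ℂ) (-q)‖ := by field_simp
    _ ≤ _ := by
      refine div_le_div_of_nonneg_right ?_ (norm_nonneg _)
      exact mul_le_mul (mul_le_mul (mul_le_mul le_rfl
        (norm_askeyH_sinh_le hq0 hq1 le_rfl t) (norm_nonneg _) (hn' _ _))
        (norm_askeyH_sinh_le hq0 hq1 le_rfl t) (norm_nonneg _) (mul_nonneg (hn' _ _) (hn' _ _)))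
        (norm_askeyH_sinh_le hq0 hq1 le_rfl t) (norm_nonneg _)
        (mul_nonneg (mul_nonneg (hn' _ _) (hn' _ _)) (hn' _ _))

lemma norm_askey_params_lt (hq0 : 0 < q) (hq1 : q < 1)
    (hbcd : ‖(q * a * b * c * d : ℂ)‖ < 1) (j : ℕ) :
    ‖(q * a * (q : ℂ) ^ j) * (q * b) * (q * c) * (q * d)‖ < q ^ 3 := by
  rw [show (q * a * (q : ℂ) ^ j) * (q * b) * (q * c) * (q * d) =
    (q : ℂ) ^ 3 * ((q : ℂ) ^ j * (q * a * b * c * d)) by ring, norm_mul, norm_pow,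
    Complex.norm_real, Real.norm_of_nonneg hq0.le]
  exact mul_lt_of_lt_one_right (by positivity) ((norm_pow_mul_le hq0 hq1 _ j).trans_lt hbcd)

/-- Askey's integral at p₁ = qaq^j produces the reciprocal of the z-dependent part of the
interpolant at q^j, so j disappears from the right side. -/
lemma interpolant_mul_integral (hq0 : 0 < q) (hq1 : q < 1) (hb : ‖(q * a * b : ℂ)‖ < 1)
    (hc : ‖(q * a * c : ℂ)‖ < 1) (hd : ‖(q * a * d : ℂ)‖ < 1)
    (hbcd : ‖(q * a * b * c * d : ℂ)‖ < 1) (j : ℕ) :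
    interpolant q a b c d ((q : ℂ) ^ j) *
        ∫ t, askeyWeight q (q * a * (q : ℂ) ^ j) (q * b) (q * c) (q * d) t =
      qPochInfList q [(q : ℂ), q * a * b, q * a * c, q * a * d, q * b * c, q * b * d, q * c * d] /
          qPochInf q (q * a * b * c * d) * (Real.log q⁻¹ : ℂ) := by
  have hq : (q : ℂ) ≠ 0 := by exact_mod_cast hq0.ne'
  have h := integral_askeyWeight hq0 hq1 (norm_askey_params_lt hq0 hq1 hbcd j)
  rw [show (q * a * (q : ℂ) ^ j) * (q * b) * (q * c) * (q * d) / (q : ℂ) ^ 3 =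
      q * a * b * c * d * (q : ℂ) ^ j by field_simp,
    show (q * a * (q : ℂ) ^ j) * (q * b) / (q : ℂ) = q * a * b * (q : ℂ) ^ j by field_simp,
    show (q * a * (q : ℂ) ^ j) * (q * c) / (q : ℂ) = q * a * c * (q : ℂ) ^ j by field_simp,
    show (q * a * (q : ℂ) ^ j) * (q * d) / (q : ℂ) = q * a * d * (q : ℂ) ^ j by field_simp,
    show (q * b) * (q * c) / (q : ℂ) = q * b * c by field_simp,
    show (q * b) * (q * d) / (q : ℂ) = q * b * d by field_simp,
    show (q * c) * (q * d) / (q : ℂ) = q * c * d by field_simp] at h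
  have nb := qPochInf_mul_pow_ne_zero hq0 hq1 hb j
  have nc := qPochInf_mul_pow_ne_zero hq0 hq1 hc j
  have nd := qPochInf_mul_pow_ne_zero hq0 hq1 hd j
  have mbcd := qPochInf_ne_zero_of_norm_lt_one hq0 hq1 hbcd
  rw [interpolant, mul_assoc, div_mul_eq_mul_div (qPochInf q (q * a * b * c * d * (q : ℂ) ^ j)), h]
  simp only [qPochInfList, List.map_cons, List.map_nil, List.prod_cons, List.prod_nil, mul_one]
  field_simp

lemma sum_qBinomialCoeff_mul_pow_self (hq0 : 0 < q) (hq1 : q < 1) (k : ℕ) :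
    ∑ j ∈ Finset.range (k + 1), qBinomialCoeff q k j * (q : ℂ) ^ j = if k = 0 then 1 else 0 := by
  rw [sum_qBinomialCoeff_mul_pow hq0 hq1]
  split_ifs with hk
  · simp [hk]
  · have := prod_one_sub_pow_mul_inv_eq_zero hq0 (Nat.pos_of_ne_zero hk)
    simpa using this

lemma integral_reversalWeight_mul_reversalSeries (hq0 : 0 < q) (hq1 : q < 1)
    (hb : ‖(q * a * b : ℂ)‖ < 1) (hc : ‖(q * a * c : ℂ)‖ < 1) (hd : ‖(q * a * d : ℂ)‖ < 1)
    (hbcd : ‖(q * a * b * c * d : ℂ)‖ < 1) (k : ℕ) :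
    ∫ t, reversalWeight q a b c d t * reversalSeries q a b c d t k =
      (if k = 0 then 1 else 0) *
      (qPochInfList q [(q : ℂ), q * a * b, q * a * c, q * a * d, q * b * c, q * b * d, q * c * d] /
          qPochInf q (q * a * b * c * d) * (Real.log q⁻¹ : ℂ)) := by
  simp only [reversalWeight_mul_reversalSeries hq0 hq1 hb hc hd hbcd]
  rw [integral_finsetSum _ fun j _ =>
    (integrable_askeyWeight hq0 hq1 (norm_askey_params_lt hq0 hq1 hbcd j)).const_mul _,
    ← sum_qBinomialCoeff_mul_pow_self hq0 hq1, Finset.sum_mul]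
  refine Finset.sum_congr rfl fun j _ => ?_
  rw [integral_const_mul, mul_assoc, interpolant_mul_integral hq0 hq1 hb hc hd hbcd]

lemma continuous_reversalWeight_mul_reversalSeries (hq0 : 0 < q) (hq1 : q < 1)
    (hb : ‖(q * a * b : ℂ)‖ < 1) (hc : ‖(q * a * c : ℂ)‖ < 1) (hd : ‖(q * a * d : ℂ)‖ < 1)
    (hbcd : ‖(q * a * b * c * d : ℂ)‖ < 1) (k : ℕ) :
    Continuous fun t => reversalWeight q a b c d t * reversalSeries q a b c d t k := by
  simp only [reversalWeight_mul_reversalSeries hq0 hq1 hb hc hd hbcd]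
  exact continuous_finsetSum _ fun j _ => (continuous_askeyWeight hq0 hq1).const_mul _

/-- The coefficient of the `₄φ₃` series in the `k`-th term. -/
noncomputable def reversalCoeff (q α a x : ℝ) (k : ℕ) : ℂ :=
  ((x ^ (α + k) : ℝ) : ℂ) * qPochReal q ((a : ℂ) / x) (α + k) /
      ((a : ℂ) ^ k * qPochReal q q (α + k))

lemma reversalTerm_eq (α x t : ℝ) (k : ℕ) :
    reversalTerm q α a x b c d t k = reversalCoeff q α a x k * reversalSeries q a b c d t k := rfl

/-- Apart from (x/a)^k and constants, the coefficient is a quotient of products (wq^{α+k};q)_∞, each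
tending to 1; a convergent sequence is bounded. -/
lemma exists_norm_reversalCoeff_le (hq0 : 0 < q) (hq1 : q < 1) (α : ℝ) {x : ℝ}
    (ha : 0 < a) (hax : a < x) :
    ∃ C : ℝ, 0 ≤ C ∧ ∀ k, ‖reversalCoeff q α a x k‖ ≤ C * (x / a) ^ k := by
  have hx : 0 < x := ha.trans hax
  have hac : (a : ℂ) ≠ 0 := by exact_mod_cast ha.ne'
  have hpow : Tendsto (fun k : ℕ => (((q ^ (α + k) : ℝ)) : ℂ)) atTop (𝓝 ((0 : ℝ) : ℂ)) := by
    refine (Complex.continuous_ofReal.tendsto 0).comp ?_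
    have h := (tendsto_pow_atTop_nhds_zero_of_lt_one hq0.le hq1).const_mul (q ^ α)
    rw [mul_zero] at h
    refine h.congr fun k => ?_
    rw [Real.rpow_add hq0, Real.rpow_natCast]
  have hlim : ∀ w : ℂ, Tendsto (fun k : ℕ => qPochInf q (w * ((q ^ (α + k) : ℝ) : ℂ))) atTop
      (𝓝 1) := by
    intro w
    have h := ((continuous_qPochInf hq0 hq1).tendsto _).comp (hpow.const_mul w)
    simpa [qPochInf_zero, Function.comp_def] using h
  have hquot := (hlim q).div (hlim ((a : ℂ) / x)) one_ne_zero
  obtain ⟨K, hK⟩ := (Metric.isBounded_range_of_tendsto _ hquot).exists_norm_le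
  have hK' : ∀ k : ℕ, ‖qPochInf q (q * ((q ^ (α + k) : ℝ) : ℂ)) /
      qPochInf q ((a : ℂ) / x * ((q ^ (α + k) : ℝ) : ℂ))‖ ≤ K := fun k => hK _ ⟨k, rfl⟩
  have hK0 : 0 ≤ K := (norm_nonneg _).trans (hK' 0)
  refine ⟨x ^ α * ‖qPochInf q ((a : ℂ) / x) / qPochInf q q‖ * K,
    mul_nonneg (mul_nonneg (Real.rpow_nonneg hx.le _) (norm_nonneg _)) hK0, fun k => ?_⟩
  have e : reversalCoeff q α a x k = (((x ^ α * (x / a) ^ k : ℝ)) : ℂ) *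
      (qPochInf q ((a : ℂ) / x) / qPochInf q q) *
      (qPochInf q (q * ((q ^ (α + k) : ℝ) : ℂ)) /
        qPochInf q ((a : ℂ) / x * ((q ^ (α + k) : ℝ) : ℂ))) := by
    rw [reversalCoeff, qPochReal, qPochReal, Real.rpow_add hx, Real.rpow_natCast, div_pow]
    push_cast
    simp only [div_eq_mul_inv, mul_inv, inv_inv]
    ring
  rw [e, norm_mul, norm_mul, Complex.norm_real, Real.norm_of_nonneg
    (mul_nonneg (Real.rpow_nonneg hx.le _) (by positivity))]
  calc _ ≤ x ^ α * (x / a) ^ k * ‖qPochInf q ((a : ℂ) / x) / qPochInf q q‖ * K :=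
        mul_le_mul_of_nonneg_left (hK' k) (mul_nonneg (mul_nonneg (Real.rpow_nonneg hx.le _)
          (by positivity)) (norm_nonneg _))
    _ = _ := by ring

end Reversal

/-! ### Exchange of sum and integral, and the final evaluation. -/

theorem mainTheorem3 (q α a x : ℝ) (b c d : ℂ)
    (hq0 : 0 < q) (hq1 : q < 1) (hα : 0 < α) (ha : 0 < a) (hax : a < x)
    (hb : ‖(q * x * b : ℂ)‖ < 1) (hc : ‖(q * x * c : ℂ)‖ < 1) (hd : ‖(q * x * d : ℂ)‖ < 1)
    (hbcd : ‖(q * x * b * c * d : ℂ)‖ < 1) :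
    (∀ t : ℝ, Summable fun k : ℕ => reversalTerm q α a x b c d t k) ∧
    MeasureTheory.Integrable (fun t : ℝ =>
      reversalWeight q a b c d t * ∑' k : ℕ, reversalTerm q α a x b c d t k) ∧
    ∫ t : ℝ, reversalWeight q a b c d t * ∑' k : ℕ, reversalTerm q α a x b c d t k =
      qPochInfList q [(q : ℂ), q * a * b, q * a * c, q * a * d, q * b * c, q * b * d, q * c * d] /
          qPochInf q (q * a * b * c * d) *
        (((x ^ α : ℝ) : ℂ) * qPochReal q ((a : ℂ) / x) α / qPochReal q q α) *
        (Real.log q⁻¹ : ℂ) := by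
  have hx : 0 < x := ha.trans hax
  -- The hypotheses are open conditions in x, so they persist for some y > x.
  obtain ⟨y, hxy, hb', hc', hd', hbcd'⟩ : ∃ y : ℝ, x < y ∧ ‖(q * y * b : ℂ)‖ < 1 ∧
      ‖(q * y * c : ℂ)‖ < 1 ∧ ‖(q * y * d : ℂ)‖ < 1 ∧ ‖(q * y * b * c * d : ℂ)‖ < 1 := by
    have hev : ∀ w : ℂ, ‖(q * x * w : ℂ)‖ < 1 → ∀ᶠ y : ℝ in 𝓝[>] x, ‖(q * y * w : ℂ)‖ < 1 := by
      intro w hw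
      have hcont : Continuous fun y : ℝ => ‖(q * y * w : ℂ)‖ := by fun_prop
      exact ((hcont.tendsto x).mono_left nhdsWithin_le_nhds).eventually_lt_const hw
    have h4 := hev (b * c * d) (by simpa only [mul_assoc] using hbcd)
    obtain ⟨y, ⟨⟨⟨h1, h2⟩, h3⟩, h4⟩, h5⟩ := ((((hev b hb).and (hev c hc)).and (hev d hd)).and
      h4 |>.and self_mem_nhdsWithin).exists
    exact ⟨y, h5, h1, h2, h3, by simpa only [mul_assoc] using h4⟩
  have hy : 0 < y := hx.trans hxy
  -- Since aR = y, the disc |z| ≤ R avoids the poles of the interpolant, and decay R^{-k} beats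
  -- growth (x/a)^k with ratio x/y.
  set R := y / a with hRdef
  have haR : a * R = y := by rw [hRdef]; field_simp
  have hR : 1 < R := by rw [hRdef, one_lt_div ha]; exact hax.trans hxy
  have hR0 : 0 < R := one_pos.trans hR
  have hmul : ∀ w : ℂ, ‖(q * a * w : ℂ)‖ * R = ‖(q * y * w : ℂ)‖ := by
    intro w
    rw [← haR, norm_mul, norm_mul, norm_mul, norm_mul]
    simp only [Complex.norm_real]
    rw [Real.norm_of_nonneg ha.le, Real.norm_of_nonneg (by positivity : 0 ≤ a * R)]
    ring
  have hlt : ∀ w : ℂ, ‖(q * y * w : ℂ)‖ < 1 → ‖(q * a * w : ℂ)‖ < 1 := fun w hw => by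
    rw [← hmul] at hw
    nlinarith [norm_nonneg (q * a * w : ℂ)]
  have hab := hlt b hb'
  have hac := hlt c hc'
  have had := hlt d hd'
  have habcd : ‖(q * a * b * c * d : ℂ)‖ < 1 := by
    have := hlt (b * c * d) (by simpa only [mul_assoc] using hbcd')
    simpa only [mul_assoc] using this
  obtain ⟨C₁, hC₁, hser⟩ := exists_norm_reversalSeries_le hq0 hq1 ha hR (by rwa [hmul])
    (by rwa [hmul]) (by rwa [hmul]) habcd
  obtain ⟨C₂, hC₂, hcoef⟩ := exists_norm_reversalCoeff_le hq0 hq1 α ha hax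
  set G : ℝ → ℝ := fun t => qPochMajorant q (q * a * R * Real.exp t) *
    qPochMajorant q (q * a * R * Real.exp (-t)) / ‖askeyH q (Complex.I * Real.sinh t) (q * a)‖
    with hG
  have hG0 : ∀ t, 0 ≤ G t := fun t =>
    div_nonneg (mul_nonneg (norm_nonneg _) (norm_nonneg _)) (norm_nonneg _)
  have hρ0 : 0 ≤ x / y := by positivity
  have hρ1 : x / y < 1 := (div_lt_one hy).2 hxy
  have hterm : ∀ t k, ‖reversalTerm q α a x b c d t k‖ ≤ C₂ * C₁ * G t * (x / y) ^ k := by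
    intro t k
    rw [reversalTerm_eq, norm_mul]
    calc _ ≤ (C₂ * (x / a) ^ k) * (C₁ * G t * (R⁻¹) ^ k) :=
          mul_le_mul (hcoef k) (hser t k) (norm_nonneg _) (by positivity)
      _ = C₂ * C₁ * G t * ((x / a) * R⁻¹) ^ k := by rw [mul_pow]; ring
      _ = _ := by rw [show x / a * R⁻¹ = x / y by rw [hRdef]; field_simp]
  have hgeo := summable_geometric_of_lt_one hρ0 hρ1
  have hsummable : ∀ t : ℝ, Summable fun k : ℕ => reversalTerm q α a x b c d t k := fun t =>
    Summable.of_norm_bounded (hgeo.mul_left _) (hterm t)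
  -- The first parameter is qaR = qy; integrability of V is exactly |qybcd| < 1.
  set V : ℝ → ℝ := weightMajorant q (q * a * R) ‖(q * b : ℂ)‖ ‖(q * c : ℂ)‖ ‖(q * d : ℂ)‖ with hV
  have hVint : Integrable V := by
    refine integrable_weightMajorant hq0 hq1 (by positivity) (norm_nonneg _) (norm_nonneg _)
      (norm_nonneg _) ?_
    have e : q * a * R * ‖(q * b : ℂ)‖ * ‖(q * c : ℂ)‖ * ‖(q * d : ℂ)‖ =
        q ^ 3 * ‖(q * y * b * c * d : ℂ)‖ := by
      rw [mul_assoc q a R, haR]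
      simp only [norm_mul, Complex.norm_real]
      rw [Real.norm_of_nonneg hq0.le, Real.norm_of_nonneg hy.le]
      ring
    rw [e]
    exact mul_lt_of_lt_one_right (by positivity) hbcd'
  have hwterm : ∀ t k, ‖reversalWeight q a b c d t * reversalTerm q α a x b c d t k‖ ≤
      C₂ * C₁ * V t * (x / y) ^ k := by
    intro t k
    rw [norm_mul]
    calc _ ≤ ‖reversalWeight q a b c d t‖ * (C₂ * C₁ * G t * (x / y) ^ k) := by
          gcongr; exact hterm t k
      _ = C₂ * C₁ * (‖reversalWeight q a b c d t‖ * G t) * (x / y) ^ k := by ring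
      _ ≤ _ := by gcongr; exact norm_reversalWeight_mul_le hq0 hq1 t _
  have hmeas : ∀ k, AEStronglyMeasurable (fun t =>
      reversalWeight q a b c d t * reversalTerm q α a x b c d t k) := by
    intro k
    have := (continuous_reversalWeight_mul_reversalSeries hq0 hq1 hab hac had habcd k).const_mul
      (reversalCoeff q α a x k)
    refine (this.congr fun t => ?_).aestronglyMeasurable
    rw [reversalTerm_eq]; ring
  have hhas : ∀ t, HasSum (fun k => reversalWeight q a b c d t * reversalTerm q α a x b c d t k)
      (reversalWeight q a b c d t * ∑' k : ℕ, reversalTerm q α a x b c d t k) := fun t =>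
    (hsummable t).hasSum.mul_left _
  have hbint : Integrable fun t => ∑' k : ℕ, C₂ * C₁ * V t * (x / y) ^ k := by
    simp only [tsum_mul_left]
    exact (hVint.const_mul _).mul_const _
  refine ⟨hsummable, ?_, ?_⟩
  · refine hbint.mono' (aestronglyMeasurable_of_tendsto_ae atTop
      (fun n => Finset.aestronglyMeasurable_fun_sum (Finset.range n) fun k _ => hmeas k)
      (.of_forall fun t => (hhas t).tendsto_sum_nat)) (.of_forall fun t => ?_)
    rw [← (hhas t).tsum_eq]
    exact tsum_of_norm_bounded (hgeo.mul_left _).hasSum (hwterm t)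
  · have hmain := hasSum_integral_of_dominated_convergence (μ := volume)
      (fun k t => C₂ * C₁ * V t * (x / y) ^ k)
      hmeas (fun k => .of_forall fun t => hwterm t k) (.of_forall fun t => hgeo.mul_left _) hbint
      (.of_forall hhas)
    have hval : ∀ k, ∫ t, reversalWeight q a b c d t * reversalTerm q α a x b c d t k =
        reversalCoeff q α a x k * ((if k = 0 then 1 else 0) * (qPochInfList q
          [(q : ℂ), q * a * b, q * a * c, q * a * d, q * b * c, q * b * d, q * c * d] /
          qPochInf q (q * a * b * c * d) * (Real.log q⁻¹ : ℂ))) := by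
      intro k
      rw [← integral_reversalWeight_mul_reversalSeries hq0 hq1 hab hac had habcd k,
        ← integral_const_mul]
      refine integral_congr_ae (.of_forall fun t => ?_)
      simp only [reversalTerm_eq]
      ring
    -- Every integral with k ≠ 0 vanishes, and the coefficient at k = 0 supplies the factor
    -- depending on x and α.
    rw [← hmain.tsum_eq, tsum_eq_single 0 fun k hk => by rw [hval, if_neg hk]; ring, hval, if_pos rfl,
      reversalCoeff]
    simp only [Nat.cast_zero, add_zero, pow_zero, one_mul]
    ring
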